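/- **Theorem (output synchronization).** Let $N\ge 1$, $M,p,q\ge 0$. Consider $N$ nodes and $M$ edges $$\dot x_i=A_ix_i+B_iu_i+D_iv_i,\quad y_i=C_ix_i\in\mathbb R^p\ (i\le N),\qquad \dot z_j=E_jz_j+F_js_j,\quad w_j=G_jz_j\in\mathbb R^p\ (j\le M),$$ coupled by $v_i=-\sum_{j}h_{ij}w_j$ and $s_j=\sum_{i}h_{ij}y_i$, where $H=(h_{ij})\in\mathbb R^{N\times M}$ is the incidence matrix of the network: edge $j$ joins two distinct nodes, with $h_{ij}=1$ if $i$ is its positive end, $h_{ij}=-1$ if $i$ is its negative end, and $h_{ij}=0$ otherwise. Let $S_\eta\in\mathbb R^{q\times q}$, $Q_\eta\in\mathbb R^{p\times q}$, $B_\eta\in\mathbb R^{q\times p}$, and for $\epsilon>0$ use the controller $$\dot\eta_i=S_\eta\eta_i+\epsilon B_\eta v_i,\qquad \dot\zeta_i=G_{1i}\zeta_i+G_{2i}(y_i-Q_\eta\eta_i),\qquad u_i=K_{xi}x_i+K_{\zeta i}\zeta_i .$$ Assume: * A1) all $B_i,D_i,F_j$ have full column rank and all $C_i,G_j$ have full row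 rank; * A2) all eigenvalues of $S_\eta$ lie on the imaginary axis and have algebraic multiplicity $1$; * A3) every edge system $(E_j,F_j,G_j)$ is strictly positive real: with $W_j(s)=G_j(sI-E_j)^{-1}F_j$ there is $\delta>0$ such that every eigenvalue of $E_j$ has real part at most $-\delta$, $W_j(s-\delta)+W_j(s-\delta)^*\succeq 0$ whenever $\operatorname{Re}s>0$, and this Hermitian matrix is nonsingular for at least one such $s$; * A4) the network is connected: $\operatorname{rank}H=N-1$; * every pair $(G_{1i},G_{2i})$ incorporates a $p$-copy internal model of $S_\eta$: $G_{1i}=T\begin{bmatrix}S_1&S_2\\0&\operatorname{diag}(\alpha_1,\dots,\alpha_p)\end{bmatrix}T^{-1}$ and $G_{2i}=T\begin{bmatrix}S_3\\ \operatorname{diag}(\beta_1,\dots,\beta_p)\end{bmatrix}$ for some invertible $T$ and matrices $S_1,S_2,S_3$, where each $(\alpha_k,\beta_k)$ is controllable with $\beta_k$ a column, and the minimal polynomial of $S_\eta$ divides the characteristic polynomial of each $\alpha_k$; * A5) for every $i$, with $\hat A_i=\begin{bmatrix}A_i+B_iK_{xi}&B_iK_{\zeta i}\\G_{2i}C_i&G_{1i}\end{bmatrix}$,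 $\hat D_i=\begin{bmatrix}D_i\\0\end{bmatrix}$, $\hat C_i=[\,C_i\ \ 0\,]$, the matrix $\hat A_i$ is Hurwitz and the system $\dot\xi=\hat A_i\xi+\hat D_iv$, $y=\hat C_i\xi$ is passive: there is a function $V\ge 0$ of the state with $V(\xi(T))\le V(\xi(0))+\int_0^T v^{\mathsf T}y\,dt$ for all $T\ge0$, all continuous inputs $v$ and all trajectories; * $B_\eta=P_\eta^{-1}Q_\eta^{\mathsf T}$ with $P_\eta$ symmetric positive definite and $P_\eta S_\eta+S_\eta^{\mathsf T}P_\eta\preceq 0$ (so that $(S_\eta,B_\eta,Q_\eta)$ is passive). Then there is $\epsilon^*>0$, depending only on these data, such that for every $0<\epsilon<\epsilon^*$ the controller solves the output synchronization problem: along every solution of the closed loop on $[0,\infty)$ there is a common trajectory $y_\eta=Q_\eta\eta_0$ with $\dot\eta_0=S_\eta\eta_0$ such that $y_i(t)-y_\eta(t)\to0$ as $t\to\infty$ for all $i$; and the common trajectory is nontrivial in the sense that, if $Q_\eta\ne0$, there is a closed-loop solution for which no $y_i(t)$ tends to $0$. Moreover, along every closed-loop solution, $$y_i(t)-Q_\eta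 e^{S_\eta t}\,\frac1N\sum_{k=1}^N\eta_k(0)\longrightarrow 0\quad(t\to\infty),\qquad i=1,\dots,N .$$ -/

import Mathlib

open Matrix Filter Topology Set
open scoped ComplexOrder

namespace DynamicEdgeNetwork

/-! ## Linear systems -/

/-- The entrywise complexification of a real matrix. -/
noncomputable abbrev cpx {m n : Type*} (A : Matrix m n ℝ) : Matrix m n ℂ :=
  A.map Complex.ofReal

/-- All (complex) eigenvalues of `A` have negative real part. -/
def IsHurwitz {n : Type*} [Fintype n] [DecidableEq n] (A : Matrix n n ℝ) : Prop :=
  ∀ l ∈ (cpx A).charpoly.roots, l.re < 0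

/-- All (complex) eigenvalues of `S` lie on the imaginary axis and have algebraic
multiplicity one. -/
def HasSimpleImaginarySpectrum {n : Type*} [Fintype n] [DecidableEq n]
    (S : Matrix n n ℝ) : Prop :=
  (∀ l ∈ (cpx S).charpoly.roots, l.re = 0) ∧
    ∀ l ∈ (cpx S).charpoly.roots, (cpx S).charpoly.rootMultiplicity l = 1

/-- `x` solves `x' = A x + B u` on `[0, ∞)` (with the one-sided derivative at `0`). -/
def IsStateTrajectory {n m : Type*} [Fintype n] [Fintype m]
    (A : Matrix n n ℝ) (B : Matrix n m ℝ) (u : ℝ → m → ℝ) (x : ℝ → n → ℝ) : Prop :=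
  ∀ t, 0 ≤ t → HasDerivWithinAt x (A *ᵥ x t + B *ᵥ u t) (Ici 0) t

/-- The linear system `x' = A x + B u`, `y = C x` is passive: there is a nonnegative storage
function `V` whose increase along every trajectory is at most the supplied energy `∫ uᵀ y`. -/
def IsPassive {n p : Type*} [Fintype n] [Fintype p]
    (A : Matrix n n ℝ) (B : Matrix n p ℝ) (C : Matrix p n ℝ) : Prop :=
  ∃ V : (n → ℝ) → ℝ, (∀ x, 0 ≤ V x) ∧
    ∀ (u : ℝ → p → ℝ) (x : ℝ → n → ℝ), Continuous u → IsStateTrajectory A B u x →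
      ∀ T, 0 ≤ T → V (x T) ≤ V (x 0) + ∫ t in (0 : ℝ)..T, u t ⬝ᵥ (C *ᵥ x t)

/-- The transfer function `C (s I - A)⁻¹ B`. -/
noncomputable def transferFunction {n p : Type*} [Fintype n] [DecidableEq n]
    (A : Matrix n n ℝ) (B : Matrix n p ℝ) (C : Matrix p n ℝ) (s : ℂ) : Matrix p p ℂ :=
  cpx C * (s • (1 : Matrix n n ℂ) - cpx A)⁻¹ * cpx B

/-- The linear system `(A, B, C)` with transfer function `H` is strictly positive real:
for some `δ > 0` the shifted function `s ↦ H (s - δ)` is positive real, that is, the system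
matrix `A + δ I` has no eigenvalue in the open right half-plane, and
`H (s - δ) + H (s - δ)ᴴ ≥ 0` there; moreover (the usual normal rank condition) this Hermitian
part is not everywhere singular. -/
def IsStrictlyPositiveReal {n p : Type*} [Fintype n] [DecidableEq n] [Fintype p] [DecidableEq p]
    (A : Matrix n n ℝ) (B : Matrix n p ℝ) (C : Matrix p n ℝ) : Prop :=
  ∃ δ : ℝ, 0 < δ ∧ (∀ l ∈ (cpx A).charpoly.roots, l.re ≤ -δ) ∧
    (∀ s : ℂ, 0 < s.re →
      (transferFunction A B C (s - δ) + (transferFunction A B C (s - δ))ᴴ).PosSemidef) ∧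
    ∃ s : ℂ, 0 < s.re ∧
      (transferFunction A B C (s - δ) + (transferFunction A B C (s - δ))ᴴ).det ≠ 0

/-- Controllability of a single-input pair: `b, a b, …, a ^ (d - 1) b` span the state space. -/
def IsControllablePair {d : ℕ} (a : Matrix (Fin d) (Fin d) ℝ) (b : Fin d → ℝ) : Prop :=
  Submodule.span ℝ (Set.range fun k : Fin d => (a ^ (k : ℕ)) *ᵥ b) = ⊤

/-- The pair `(G₁, G₂)` incorporates a `p`-copy internal model of `S`:
`G₁ = T [S₁ S₂; 0 diag(α₁, …, α_p)] T⁻¹` and `G₂ = T [S₃; diag(β₁, …, β_p)]` with `T` invertible,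
`(α_k, β_k)` controllable, and the minimal polynomial of `S` dividing the characteristic
polynomial of every `α_k`. -/
def IncorporatesInternalModel {q c p : ℕ} (S : Matrix (Fin q) (Fin q) ℝ)
    (G₁ : Matrix (Fin c) (Fin c) ℝ) (G₂ : Matrix (Fin c) (Fin p) ℝ) : Prop :=
  ∃ (r : ℕ) (d : Fin p → ℕ)
    (α : ∀ k, Matrix (Fin (d k)) (Fin (d k)) ℝ) (β : ∀ k, Fin (d k) → ℝ)
    (S₁ : Matrix (Fin r) (Fin r) ℝ) (S₂ : Matrix (Fin r) (Σ k, Fin (d k)) ℝ)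
    (S₃ : Matrix (Fin r) (Fin p) ℝ)
    (T : Matrix (Fin c) (Fin r ⊕ Σ k, Fin (d k)) ℝ)
    (Tinv : Matrix (Fin r ⊕ Σ k, Fin (d k)) (Fin c) ℝ),
    T * Tinv = 1 ∧ Tinv * T = 1 ∧
    G₁ = T * Matrix.fromBlocks S₁ S₂ 0 (Matrix.blockDiagonal' α) * Tinv ∧
    G₂ = T * Matrix.fromRows S₃ (Matrix.of fun a k => if a.1 = k then β a.1 a.2 else 0) ∧
    ∀ k, IsControllablePair (α k) (β k) ∧ minpoly ℝ S ∣ (α k).charpoly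

/-! ## Multi-agent systems with dynamic nodes and dynamic edges -/

/-- `N` node systems `(A i, B i, C i, D i)` and `M` edge systems `(E j, F j, G j)`, where edge `j`
has positive end `pos j` and negative end `neg j`. -/
structure MultiAgentSystem (N M p : ℕ) where
  n : Fin N → ℕ
  m : Fin N → ℕ
  ne : Fin M → ℕ
  A : ∀ i, Matrix (Fin (n i)) (Fin (n i)) ℝ
  B : ∀ i, Matrix (Fin (n i)) (Fin (m i)) ℝ
  C : ∀ i, Matrix (Fin p) (Fin (n i)) ℝ
  D : ∀ i, Matrix (Fin (n i)) (Fin p) ℝ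
  E : ∀ j, Matrix (Fin (ne j)) (Fin (ne j)) ℝ
  F : ∀ j, Matrix (Fin (ne j)) (Fin p) ℝ
  G : ∀ j, Matrix (Fin p) (Fin (ne j)) ℝ
  pos : Fin M → Fin N
  neg : Fin M → Fin N
  pos_ne_neg : ∀ j, pos j ≠ neg j

/-- Dimensions `c i` and gains of the dynamic controllers of the nodes. -/
structure ControllerGains {N M p : ℕ} (sys : MultiAgentSystem N M p) where
  c : Fin N → ℕ
  G₁ : ∀ i, Matrix (Fin (c i)) (Fin (c i)) ℝ
  G₂ : ∀ i, Matrix (Fin (c i)) (Fin p) ℝ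
  Kx : ∀ i, Matrix (Fin (sys.m i)) (Fin (sys.n i)) ℝ
  Kζ : ∀ i, Matrix (Fin (sys.m i)) (Fin (c i)) ℝ

namespace MultiAgentSystem

variable {N M p : ℕ} (sys : MultiAgentSystem N M p)

/-- The incidence matrix. -/
def H : Matrix (Fin N) (Fin M) ℝ :=
  Matrix.of fun i j => if i = sys.pos j then 1 else if i = sys.neg j then -1 else 0

/-- `B i`, `D i`, `F j` have full column rank; `C i`, `G j` have full row rank. -/
def FullRank : Prop :=
  (∀ i, (sys.B i).rank = sys.m i ∧ (sys.D i).rank = p ∧ (sys.C i).rank = p) ∧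
    ∀ j, (sys.F j).rank = p ∧ (sys.G j).rank = p

/-- The network is connected: the incidence matrix has rank `N - 1` (in particular `N ≥ 1`). -/
def IsConnected : Prop := sys.H.rank + 1 = N

end MultiAgentSystem

namespace ControllerGains

variable {N M p : ℕ} {sys : MultiAgentSystem N M p} (K : ControllerGains sys)

/-- State matrix of node `i` in closed loop with its controller, in the state `(x i, ζ i)`. -/
def Ahat (i : Fin N) :
    Matrix (Fin (sys.n i) ⊕ Fin (K.c i)) (Fin (sys.n i) ⊕ Fin (K.c i)) ℝ :=
  Matrix.fromBlocks (sys.A i + sys.B i * K.Kx i) (sys.B i * K.Kζ i)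
    (K.G₂ i * sys.C i) (K.G₁ i)

/-- Input matrix from the neighboring input `v i` to the state `(x i, ζ i)`. -/
def Dhat (i : Fin N) : Matrix (Fin (sys.n i) ⊕ Fin (K.c i)) (Fin p) ℝ :=
  Matrix.fromRows (sys.D i) 0

/-- Output matrix from the state `(x i, ζ i)` to `y i`. -/
def Chat (i : Fin N) : Matrix (Fin p) (Fin (sys.n i) ⊕ Fin (K.c i)) ℝ :=
  Matrix.fromCols (sys.C i) 0

end ControllerGains

/-- The signals of the closed loop: node states `x`, inputs `u`, neighboring inputs `v` and
outputs `y`; edge states `z`, inputs `s` and outputs `w`; exosystem states `η` and controller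
states `ζ`. -/
structure Signals {N M p : ℕ} {sys : MultiAgentSystem N M p} (K : ControllerGains sys)
    (q : ℕ) where
  x : ∀ i, ℝ → Fin (sys.n i) → ℝ
  u : ∀ i, ℝ → Fin (sys.m i) → ℝ
  v : Fin N → ℝ → Fin p → ℝ
  y : Fin N → ℝ → Fin p → ℝ
  z : ∀ j, ℝ → Fin (sys.ne j) → ℝ
  s : Fin M → ℝ → Fin p → ℝ
  w : Fin M → ℝ → Fin p → ℝ
  η : Fin N → ℝ → Fin q → ℝ
  ζ : ∀ i, ℝ → Fin (K.c i) → ℝ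

/-- The signals form a solution on `[0, ∞)` of the multi-agent system in closed loop with the
adaptive-exosystem controller. -/
structure IsClosedLoopSolution {N M p q : ℕ} {sys : MultiAgentSystem N M p}
    (K : ControllerGains sys) (S : Matrix (Fin q) (Fin q) ℝ) (Bη : Matrix (Fin q) (Fin p) ℝ)
    (Q : Matrix (Fin p) (Fin q) ℝ) (ε : ℝ) (σ : Signals K q) : Prop where
  node_state : ∀ i t, 0 ≤ t → HasDerivWithinAt (σ.x i)
    (sys.A i *ᵥ σ.x i t + sys.B i *ᵥ σ.u i t + sys.D i *ᵥ σ.v i t) (Ici 0) t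
  node_output : ∀ i t, 0 ≤ t → σ.y i t = sys.C i *ᵥ σ.x i t
  edge_state : ∀ j t, 0 ≤ t → HasDerivWithinAt (σ.z j)
    (sys.E j *ᵥ σ.z j t + sys.F j *ᵥ σ.s j t) (Ici 0) t
  edge_output : ∀ j t, 0 ≤ t → σ.w j t = sys.G j *ᵥ σ.z j t
  neighboring_input : ∀ i t, 0 ≤ t → σ.v i t = -∑ j, sys.H i j • σ.w j t
  edge_input : ∀ j t, 0 ≤ t → σ.s j t = ∑ i, sys.H i j • σ.y i t
  exosystem : ∀ i t, 0 ≤ t → HasDerivWithinAt (σ.η i)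
    (S *ᵥ σ.η i t + ε • (Bη *ᵥ σ.v i t)) (Ici 0) t
  controller_state : ∀ i t, 0 ≤ t → HasDerivWithinAt (σ.ζ i)
    (K.G₁ i *ᵥ σ.ζ i t + K.G₂ i *ᵥ (σ.y i t - Q *ᵥ σ.η i t)) (Ici 0) t
  control_law : ∀ i t, 0 ≤ t → σ.u i t = K.Kx i *ᵥ σ.x i t + K.Kζ i *ᵥ σ.ζ i t

/-- The controller solves the output synchronization problem: along every closed-loop solution all
node outputs converge to one common trajectory `Q η₀`, with `η₀' = S η₀`; and, unless `Q = 0` (when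
every such trajectory vanishes), the common trajectory is nontrivial, in that it does not decay to
zero for all initial conditions. -/
def SolvesOutputSynchronization {N M p q : ℕ} {sys : MultiAgentSystem N M p}
    (K : ControllerGains sys) (S : Matrix (Fin q) (Fin q) ℝ) (Bη : Matrix (Fin q) (Fin p) ℝ)
    (Q : Matrix (Fin p) (Fin q) ℝ) (ε : ℝ) : Prop :=
  (∀ σ : Signals K q, IsClosedLoopSolution K S Bη Q ε σ →
    ∃ η₀ : ℝ → Fin q → ℝ, (∀ t, 0 ≤ t → HasDerivWithinAt η₀ (S *ᵥ η₀ t) (Ici 0) t) ∧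
      ∀ i, Tendsto (fun t => σ.y i t - Q *ᵥ η₀ t) atTop (𝓝 0)) ∧
  (Q ≠ 0 → ∃ σ : Signals K q, IsClosedLoopSolution K S Bη Q ε σ ∧
    ∀ i, ¬ Tendsto (σ.y i) atTop (𝓝 0))

end DynamicEdgeNetwork

/-! The closed loop is a linear autonomous system, so the theorem reduces to its modes with
eigenvalue `l` in the closed right half-plane. The synchronization error `y i - Q (average of η)` is
a linear output. It decays along every solution once it vanishes on all such modes and these
eigenvalues are semisimple (`tendsto_output_zero`).

The modes are controlled by a power balance. Strict positive realness gives each edge `Re (s* w) ≥ c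
‖w‖²` with `c` independent of `l` (`IsStrictlyPositiveReal.exists_output_strict_passive`). Each
node, together with its exosystem, satisfies `Re (v* y) ≥ -ε b ‖v‖²`, again uniformly in `l`
(`exists_node_bound`). Up to an error of size `ε ‖v‖`, its state is a passive response to `v` plus a
regulated part whose output is `Q η`, and the exosystem is passive as well. The incidence coupling
preserves power, and `∑ ‖v‖² ≤ N M ∑ ‖w‖²`. For small `ε` the edge term therefore dominates and
forces `w = 0`. Then `v = 0`, strictness gives `s = 0`, connectedness makes all `y i` equal, and `y
i = Q (η i)` (`exists_gain_unstable_modes`).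

Semisimplicity comes from the weight `P`: along a Jordan chain, `∑ (η i)* P (η i)` equals `ε` times
the pairing of the common output with `∑ v i`, and this sum is zero (`unstable_modes_semisimple`).
The same identity makes the average of the `η i` evolve by `S` alone, which identifies the limit.
Nontriviality holds because imaginary eigenvalues give modes of constant modulus, at least one of
which `Q ≠ 0` detects. -/

namespace DynamicEdgeNetwork

/-! ### Linear differential equations and decay of outputs -/

section LinearODE

variable {E F : Type*} [NormedAddCommGroup E] [NormedSpace ℂ E] [FiniteDimensional ℂ E]
  [NormedAddCommGroup F] [NormedSpace ℂ F]

/-- The semigroup generated by `A` solves the linear differential equation. -/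
theorem hasDerivAt_exp_smul_apply (A : E →L[ℂ] E) (x : E) (t : ℝ) :
    HasDerivAt (fun t : ℝ => NormedSpace.exp (t • A) x) (A (NormedSpace.exp (t • A) x)) t := by
  have : CompleteSpace E := FiniteDimensional.complete ℂ E
  have h := (hasDerivAt_exp_smul_const' (𝕂 := ℝ) A t)
  have h2 := ((ContinuousLinearMap.apply ℂ E x).restrictScalars ℝ).hasFDerivAt.comp_hasDerivAt t h
  exact h2

omit [FiniteDimensional ℂ E] in
theorem exp_zero_smul_apply (A : E →L[ℂ] E) (x : E) : NormedSpace.exp ((0 : ℝ) • A) x = x := by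
  simp

/-- Uniqueness of solutions of linear differential equations on `[0, ∞)`. -/
theorem linearODE_unique {V : Type*} [NormedAddCommGroup V] [NormedSpace ℝ V] (A : V →L[ℝ] V)
    {X Y : ℝ → V} (hX : ∀ t, 0 ≤ t → HasDerivWithinAt X (A (X t)) (Ici 0) t)
    (hY : ∀ t, 0 ≤ t → HasDerivWithinAt Y (A (Y t)) (Ici 0) t) (h0 : X 0 = Y 0)
    (t : ℝ) (ht : 0 ≤ t) : X t = Y t :=
  ODE_solution_unique_of_mem_Icc_right (v := fun _ x => A x) (s := fun _ => univ)
    (K := ‖A‖₊) (f := X) (g := Y) (a := 0) (b := t)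
    (fun _ _ => A.lipschitz.lipschitzOnWith)
    (fun s hs => ((hX s hs.1).continuousWithinAt).mono Icc_subset_Ici_self)
    (fun s hs => (hX s hs.1).mono (Ici_subset_Ici.2 hs.1)) (fun _ _ => mem_univ _)
    (fun s hs => ((hY s hs.1).continuousWithinAt).mono Icc_subset_Ici_self)
    (fun s hs => (hY s hs.1).mono (Ici_subset_Ici.2 hs.1)) (fun _ _ => mem_univ _)
    h0 (right_mem_Icc.2 ht)

theorem eq_exp_smul_apply (A : E →L[ℂ] E) (X : ℝ → E)
    (hX : ∀ t, 0 ≤ t → HasDerivWithinAt X (A (X t)) (Ici 0) t) (t : ℝ) (ht : 0 ≤ t) :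
    X t = NormedSpace.exp (t • A) (X 0) :=
  linearODE_unique (A.restrictScalars ℝ) hX
    (fun s _ => (hasDerivAt_exp_smul_apply A (X 0) s).hasDerivWithinAt)
    (exp_zero_smul_apply A (X 0)).symm t ht

theorem hasDerivAt_exp_smul_mulVec {n : Type*} [Fintype n] [DecidableEq n] (S : Matrix n n ℝ)
    (x : n → ℝ) (t : ℝ) :
    HasDerivAt (fun t : ℝ => NormedSpace.exp (t • S) *ᵥ x)
      (S *ᵥ (NormedSpace.exp (t • S) *ᵥ x)) t := by
  let _ := Matrix.linftyOpNormedRing (n := n) (α := ℝ)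
  let _ := Matrix.linftyOpNormedAlgebra (n := n) (α := ℝ) (R := ℝ)
  have h := hasDerivAt_exp_smul_const' (𝕂 := ℝ) S t
  have h2 := (((Matrix.mulVecBilin ℝ ℝ).flip x).toContinuousLinearMap).hasFDerivAt.comp_hasDerivAt
    t h
  have h3 : S *ᵥ (NormedSpace.exp (t • S) *ᵥ x) =
    (((Matrix.mulVecBilin ℝ ℝ).flip x).toContinuousLinearMap) (S * NormedSpace.exp (t • S)) := by
    simp
  rw [h3]
  exact h2

theorem eq_exp_smul_mulVec {n : Type*} [Fintype n] [DecidableEq n] (S : Matrix n n ℝ)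
    (X : ℝ → n → ℝ) (hX : ∀ t, 0 ≤ t → HasDerivWithinAt X (S *ᵥ X t) (Ici 0) t) (t : ℝ)
    (ht : 0 ≤ t) : X t = NormedSpace.exp (t • S) *ᵥ X 0 :=
  linearODE_unique S.mulVecLin.toContinuousLinearMap hX
    (fun s _ => (hasDerivAt_exp_smul_mulVec S (X 0) s).hasDerivWithinAt) (by simp) t ht

/-- The semigroup on a generalized eigenvector. -/
theorem exp_smul_apply_of_pow_sub_apply_eq_zero (A : E →L[ℂ] E) (l : ℂ) (k : ℕ) (x : E)
    (hx : ((A - l • 1) ^ k) x = 0) (t : ℝ) :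
    NormedSpace.exp (t • A) x = Complex.exp (t * l) •
      ∑ m ∈ Finset.range k, ((m.factorial : ℂ)⁻¹ * (t : ℂ) ^ m) • ((A - l • 1) ^ m) x := by
  have : CompleteSpace E := FiniteDimensional.complete ℂ E
  let _ : NormedAlgebra ℚ (E →L[ℂ] E) := NormedAlgebra.restrictScalars ℚ ℂ _
  set B := A - l • (1 : E →L[ℂ] E) with hB
  have hA : t • A = ((t : ℂ) * l) • (1 : E →L[ℂ] E) + (t : ℂ) • B := by
    rw [hB, smul_sub, smul_smul, add_sub_cancel]; ext; simp
  have hcomm : Commute (((t : ℂ) * l) • (1 : E →L[ℂ] E)) ((t : ℂ) • B) :=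
    ((Commute.one_left B).smul_left _).smul_right _
  have h1 : NormedSpace.exp (((t : ℂ) * l) • (1 : E →L[ℂ] E)) = Complex.exp (t * l) • 1 := by
    have := NormedSpace.algebraMap_exp_comm (𝔸 := E →L[ℂ] E) ((t : ℂ) * l)
    rw [Algebra.algebraMap_eq_smul_one, Algebra.algebraMap_eq_smul_one] at this
    rw [← this, Complex.exp_eq_exp_ℂ]
  rw [hA, NormedSpace.exp_add_of_commute hcomm, h1]
  simp only [smul_mul_assoc, one_mul, _root_.smul_apply]
  congr 1
  have hs := NormedSpace.exp_series_hasSum_exp' (𝕂 := ℂ) ((t : ℂ) • B)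
  have hs' := (ContinuousLinearMap.apply ℂ E x).hasSum hs
  simp only [ContinuousLinearMap.apply_apply, _root_.smul_apply, smul_pow,
    smul_smul] at hs'
  refine hs'.unique (hasSum_sum_of_ne_finset_zero fun m hm => ?_)
  have hkm : k ≤ m := by simpa using hm
  obtain ⟨r, rfl⟩ := Nat.exists_eq_add_of_le' hkm
  rw [pow_add B, mul_apply_eq_comp, hx, map_zero, smul_zero]

theorem tendsto_exp_mul_mul_pow (l : ℂ) (hl : l.re < 0) (m : ℕ) :
    Tendsto (fun t : ℝ => Complex.exp (t * l) * (t : ℂ) ^ m) atTop (𝓝 0) := by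
  rw [tendsto_zero_iff_norm_tendsto_zero]
  have h := tendsto_rpow_mul_exp_neg_mul_atTop_nhds_zero m (-l.re) (by linarith)
  refine h.congr' ?_
  filter_upwards [eventually_ge_atTop (0 : ℝ)] with t ht
  simp [Complex.norm_exp, abs_of_nonneg ht, mul_comm]

/-- If an output vanishes on all eigenvectors for eigenvalues in the closed right half-plane, and
these eigenvalues are semisimple, then the output converges to zero along every solution. -/
theorem tendsto_output_zero (A : E →L[ℂ] E) (L : E →L[ℂ] F)
    (h1 : ∀ l : ℂ, 0 ≤ l.re → ∀ x, A x = l • x → L x = 0)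
    (h2 : ∀ l : ℂ, 0 ≤ l.re → ∀ x y, A y = l • y → A x = l • x + y → y = 0) (x : E) :
    Tendsto (fun t : ℝ => L (NormedSpace.exp (t • A) x)) atTop (𝓝 0) := by
  have hx : x ∈ ⨆ l : ℂ, Module.End.maxGenEigenspace (A : E →ₗ[ℂ] E) l := by
    rw [Module.End.iSup_maxGenEigenspace_eq_top]; trivial
  induction hx using Submodule.iSup_induction' with
  | zero => simp
  | add x y _ _ hx hy => simpa using hx.add hy
  | mem l x hx =>
    rw [Module.End.mem_maxGenEigenspace] at hx
    obtain ⟨k, hk⟩ := hx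
    have hk : ((A - l • 1) ^ k) x = 0 := by
      have h3 : ∀ (k : ℕ) (x : E), (((A : E →ₗ[ℂ] E) - l • 1) ^ k) x = ((A - l • 1) ^ k) x := by
        intro k
        induction k with
        | zero => intro x; simp
        | succ k ih => intro x; rw [pow_succ, pow_succ]; simp [ih]
      rw [← h3]; exact hk
    by_cases hl : 0 ≤ l.re
    -- No Jordan chain has length two or more, so a generalized eigenvector is an eigenvector: lower
    -- the exponent one step at a time.
    · have hk1 : ∀ (k : ℕ) (x : E), ((A - l • 1) ^ k) x = 0 → A x = l • x := by
        intro k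
        induction k with
        | zero => intro x hx; have : x = 0 := by simpa using hx
                  simp [this]
        | succ k ih =>
          intro x hx
          rw [pow_succ, mul_apply_eq_comp] at hx
          have h4 := ih _ hx
          have h5 := h2 l hl x _ h4 (by simp)
          simpa [sub_eq_zero] using h5
      have hAx := hk1 k x hk
      have : ∀ t : ℝ, L (NormedSpace.exp (t • A) x) = 0 := by
        intro t
        rw [exp_smul_apply_of_pow_sub_apply_eq_zero A l 1 x (by simp [hAx])]
        simp [h1 l hl x hAx]
      simp [this]
    · push Not at hl
      simp_rw [exp_smul_apply_of_pow_sub_apply_eq_zero A l k x hk, Finset.smul_sum, map_sum]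
      rw [← Finset.sum_const_zero (s := Finset.range k)]
      refine tendsto_finsetSum _ fun m _ => ?_
      have := ((tendsto_exp_mul_mul_pow l hl m).const_mul ((m.factorial : ℂ)⁻¹)).smul_const
        (L (((A - l • 1) ^ m) x))
      simp only [mul_zero, zero_smul] at this
      refine this.congr fun t => ?_
      rw [smul_smul, map_smul]
      congr 1
      ring

end LinearODE

/-! ### Norm and resolvent bounds -/

section Bounds

variable {m n : Type*} [Fintype m] [Fintype n]

theorem exists_norm_mulVec_le (A : Matrix m n ℂ) : ∃ a : ℝ, 0 ≤ a ∧ ∀ x, ‖A *ᵥ x‖ ≤ a * ‖x‖ :=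
  ⟨‖A.mulVecLin.toContinuousLinearMap‖, norm_nonneg _,
    A.mulVecLin.toContinuousLinearMap.le_opNorm⟩

/-- The norm on `n → ℂ` is the supremum norm, whence the factor `Fintype.card n`. -/
theorem norm_star_dotProduct_le (x y : n → ℂ) : ‖star x ⬝ᵥ y‖ ≤ Fintype.card n * ‖x‖ * ‖y‖ := by
  refine (norm_sum_le _ _).trans ?_
  have : ∀ i ∈ Finset.univ, ‖star x i * y i‖ ≤ ‖x‖ * ‖y‖ := fun i _ => by
    rw [norm_mul, Pi.star_apply, norm_star]
    exact mul_le_mul (norm_le_pi_norm x i) (norm_le_pi_norm y i) (norm_nonneg _) (norm_nonneg _)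
  refine (Finset.sum_le_sum this).trans ?_
  simp [mul_assoc]

/-- The quadratic form attains a positive minimum on the compact unit sphere; homogeneity does the
rest. -/
theorem PosDef.exists_norm_sq_le {A : Matrix n n ℂ} (hA : A.PosDef) :
    ∃ c : ℝ, 0 < c ∧ ∀ x, c * ‖x‖ ^ 2 ≤ (star x ⬝ᵥ A *ᵥ x).re := by
  have hcont : Continuous fun x : n → ℂ => (star x ⬝ᵥ A *ᵥ x).re := by fun_prop
  obtain ⟨c, hc, h⟩ := (isCompact_sphere (0 : n → ℂ) 1).exists_forall_le' hcont.continuousOn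
    (a := 0) fun x hx => hA.re_dotProduct_pos (fun h => by simp [h] at hx)
  refine ⟨c, hc, fun x => ?_⟩
  rcases eq_or_ne x 0 with rfl | hx
  · simp
  have hx' : ‖x‖ ≠ 0 := norm_ne_zero_iff.2 hx
  have := h ((‖x‖⁻¹ : ℂ) • x) (by simp [norm_smul, hx'])
  have h2 : (star ((‖x‖⁻¹ : ℂ) • x) ⬝ᵥ A *ᵥ ((‖x‖⁻¹ : ℂ) • x)) =
      ((‖x‖⁻¹ ^ 2 : ℝ) : ℂ) * (star x ⬝ᵥ A *ᵥ x) := by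
    rw [mulVec_smul, star_smul, smul_dotProduct, dotProduct_smul]
    simp [pow_two, mul_assoc]
  rw [h2, Complex.re_ofReal_mul, inv_pow, ← div_eq_inv_mul, le_div_iff₀ (by positivity)] at this
  exact this

variable [DecidableEq n]

theorem det_smul_one_sub (A : Matrix n n ℂ) (l : ℂ) :
    (l • (1 : Matrix n n ℂ) - A).det = A.charpoly.eval l := by
  rw [eval_charpoly, scalar_apply, smul_one_eq_diagonal]

theorem mem_roots_charpoly_iff (A : Matrix n n ℂ) (l : ℂ) :
    l ∈ A.charpoly.roots ↔ ∃ x, x ≠ 0 ∧ A *ᵥ x = l • x := by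
  rw [Polynomial.mem_roots A.charpoly_monic.ne_zero, Polynomial.IsRoot.def, ← det_smul_one_sub,
    ← exists_mulVec_eq_zero_iff]
  simp only [sub_mulVec, smul_mulVec, one_mulVec, sub_eq_zero, eq_comm]

/-- A resolvent bound on the closed right half-plane. -/
theorem exists_resolvent_bound (A : Matrix n n ℂ) (hA : ∀ l ∈ A.charpoly.roots, l.re < 0) :
    ∃ K : ℝ, 0 ≤ K ∧ ∀ l : ℂ, 0 ≤ l.re → ∀ x,
      (1 + ‖l‖) * ‖x‖ ≤ K * ‖l • x - A *ᵥ x‖ := by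
  obtain ⟨a, ha, hle⟩ := exists_norm_mulVec_le A
  -- For `‖l‖ ≤ a + 1` compactness bounds `l - A` below; beyond that radius, `‖l x - A x‖ ≥ (‖l‖ -
  -- a) ‖x‖ ≥ ‖x‖`.
  have hcomp : IsCompact (({l : ℂ | 0 ≤ l.re} ∩ Metric.closedBall 0 (a + 1)) ×ˢ
      Metric.sphere (0 : n → ℂ) 1) :=
    ((isCompact_closedBall _ _).inter_left
      (isClosed_le continuous_const Complex.continuous_re)).prod (isCompact_sphere _ _)
  have hcont : Continuous fun w : ℂ × (n → ℂ) => ‖w.1 • w.2 - A *ᵥ w.2‖ := by fun_prop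
  obtain ⟨c, hc, h⟩ := hcomp.exists_forall_le' hcont.continuousOn (a := 0) (by
    rintro ⟨l, x⟩ ⟨⟨hl, -⟩, hx⟩
    rw [norm_pos_iff]
    intro h0
    have := hA l ((mem_roots_charpoly_iff A l).2 ⟨x, fun h => by simp [h] at hx,
      (sub_eq_zero.1 h0).symm⟩)
    exact absurd hl (not_le.2 this))
  have key : ∀ l : ℂ, 0 ≤ l.re → ∀ x, ‖x‖ ≤ (1 + c⁻¹) * ‖l • x - A *ᵥ x‖ := by
    intro l hl x
    have hc' : 0 < c⁻¹ := inv_pos.2 hc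
    rcases le_or_gt ‖l‖ (a + 1) with hla | hla
    · rcases eq_or_ne x 0 with rfl | hx
      · simp
      have hx' : ‖x‖ ≠ 0 := norm_ne_zero_iff.2 hx
      have := h (l, (‖x‖⁻¹ : ℂ) • x) ⟨⟨hl, by simpa using hla⟩, by simp [norm_smul, hx']⟩
      simp only [mulVec_smul, smul_comm l, ← smul_sub, norm_smul] at this
      simp only [norm_inv, Complex.norm_real, norm_norm] at this
      rw [← div_eq_inv_mul, le_div_iff₀ (by positivity)] at this
      have h3 : ‖x‖ ≤ c⁻¹ * ‖l • x - A *ᵥ x‖ := by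
        rw [← div_eq_inv_mul, le_div_iff₀ hc]; linarith
      nlinarith [norm_nonneg (l • x - A *ᵥ x)]
    · have h1 : ‖l‖ * ‖x‖ ≤ ‖l • x - A *ᵥ x‖ + ‖A *ᵥ x‖ := by
        rw [← norm_smul]; simpa using norm_add_le (l • x - A *ᵥ x) (A *ᵥ x)
      nlinarith [hle x, norm_nonneg x, norm_nonneg (l • x - A *ᵥ x)]
  -- The weight `1 + ‖l‖` comes from `‖l‖ ‖x‖ ≤ ‖l x - A x‖ + a ‖x‖`, combined with `key` for the
  -- remaining `(1 + a) ‖x‖`.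
  refine ⟨1 + (1 + a) * (1 + c⁻¹), by positivity, fun l hl x => ?_⟩
  have h1 : ‖l‖ * ‖x‖ ≤ ‖l • x - A *ᵥ x‖ + ‖A *ᵥ x‖ := by
    rw [← norm_smul]; simpa using norm_add_le (l • x - A *ᵥ x) (A *ᵥ x)
  nlinarith [hle x, key l hl x]

theorem mulVec_inv_eq_of_resolvent (A : Matrix n n ℂ) {l : ℂ} (hl : l ∉ A.charpoly.roots)
    {x y : n → ℂ} (h : l • x - A *ᵥ x = y) : (l • (1 : Matrix n n ℂ) - A)⁻¹ *ᵥ y = x := by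
  have hdet : IsUnit (l • (1 : Matrix n n ℂ) - A).det := by
    rw [det_smul_one_sub, isUnit_iff_ne_zero]
    intro h0
    exact hl ((Polynomial.mem_roots A.charpoly_monic.ne_zero).2 h0)
  rw [← h]
  have : l • x - A *ᵥ x = (l • (1 : Matrix n n ℂ) - A) *ᵥ x := by
    simp [sub_mulVec, smul_mulVec]
  rw [this, mulVec_mulVec, nonsing_inv_mul _ hdet, one_mulVec]

theorem exists_resolvent_apply (A : Matrix n n ℂ) {l : ℂ} (hl : l ∉ A.charpoly.roots)
    (y : n → ℂ) : ∃ x, l • x - A *ᵥ x = y := by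
  have hdet : IsUnit (l • (1 : Matrix n n ℂ) - A).det := by
    rw [det_smul_one_sub, isUnit_iff_ne_zero]
    intro h0
    exact hl ((Polynomial.mem_roots A.charpoly_monic.ne_zero).2 h0)
  refine ⟨(l • (1 : Matrix n n ℂ) - A)⁻¹ *ᵥ y, ?_⟩
  have : ∀ x, l • x - A *ᵥ x = (l • (1 : Matrix n n ℂ) - A) *ᵥ x := by
    simp [sub_mulVec, smul_mulVec]
  rw [this, mulVec_mulVec, mul_nonsing_inv _ hdet, one_mulVec]

end Bounds

/-! ### A Harnack inequality on the half-plane -/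

section Harnack

open ComplexConjugate

/-- The Harnack inequality for holomorphic functions from the right half-plane to its closure. -/
theorem re_mul_re_le_of_re_nonneg {f : ℂ → ℂ} (hd : DifferentiableOn ℂ f {l | 0 < l.re})
    (hf : ∀ l : ℂ, 0 < l.re → 0 ≤ (f l).re) {a l : ℂ} (ha : 0 < a.re) (hl : 0 < l.re) :
    l.re * a.re * (f a).re ≤ (f l).re * ‖l + conj a‖ ^ 2 := by
  -- When `Re (f a) = 0` the denominator of the Cayley transform of `f` may vanish, but the claim is
  -- trivial.
  rcases (hf a ha).eq_or_lt with h0 | hfa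
  · rw [← h0, mul_zero]
    exact mul_nonneg (hf l hl) (by positivity)
  have hne : ∀ w b : ℂ, 0 ≤ w.re → 0 < b.re → w + conj b ≠ 0 := fun w b hw hb h => by
    have := congrArg Complex.re h
    simp at this
    linarith
  -- Cayley transforms on both sides: `ψ` maps the unit disc to the half-plane with `ψ 0 = a`, and
  -- `h` maps the disc to the closed disc with `h 0 = 0`. The Schwarz lemma then applies to `h`.
  set ψ : ℂ → ℂ := fun ζ => (a + conj a * ζ) / (1 - ζ) with hψ
  have h1ne : ∀ ζ ∈ Metric.ball (0 : ℂ) 1, (1 : ℂ) - ζ ≠ 0 := fun ζ hζ h => by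
    rw [← sub_eq_zero.1 h] at hζ; simp at hζ
  have hψre : ∀ ζ ∈ Metric.ball (0 : ℂ) 1, 0 < (ψ ζ).re := by
    intro ζ hζ
    have h1 := h1ne ζ hζ
    have h2 : (ψ ζ).re = a.re * (1 - Complex.normSq ζ) / Complex.normSq (1 - ζ) := by
      simp only [hψ, Complex.div_re, Complex.normSq_apply]
      simp
      ring
    rw [h2]
    have h3 : Complex.normSq ζ < 1 := by
      rw [Complex.normSq_eq_norm_sq]
      have : ‖ζ‖ < 1 := by simpa using hζ
      nlinarith [norm_nonneg ζ]
    exact div_pos (mul_pos ha (by linarith)) (Complex.normSq_pos.2 h1)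
  set h : ℂ → ℂ := fun ζ => (f (ψ ζ) - f a) / (f (ψ ζ) + conj (f a)) with hh
  have hhd : DifferentiableOn ℂ h (Metric.ball 0 1) := by
    have hψd : DifferentiableOn ℂ ψ (Metric.ball 0 1) :=
      DifferentiableOn.div (by fun_prop) (by fun_prop) h1ne
    have hfψ : DifferentiableOn ℂ (fun ζ => f (ψ ζ)) (Metric.ball 0 1) := hd.comp hψd hψre
    exact (hfψ.sub_const _).div (hfψ.add_const _) fun ζ hζ => hne _ _ (hf _ (hψre ζ hζ)) hfa
  have hid : ∀ w b : ℂ, ‖w + conj b‖ ^ 2 = ‖w - b‖ ^ 2 + 4 * w.re * b.re := fun w b => by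
    rw [← Complex.normSq_eq_norm_sq, ← Complex.normSq_eq_norm_sq, Complex.normSq_apply,
      Complex.normSq_apply]
    simp
    ring
  have hmaps : MapsTo h (Metric.ball 0 1) (Metric.closedBall 0 1) := by
    intro ζ hζ
    have hr := hf _ (hψre ζ hζ)
    have hpos : 0 < ‖f (ψ ζ) + conj (f a)‖ := norm_pos_iff.2 (hne _ _ hr hfa)
    simp only [hh, mem_closedBall_zero_iff, norm_div]
    rw [div_le_one hpos]
    refine le_of_sq_le_sq ?_ hpos.le
    rw [hid]
    nlinarith [mul_nonneg hr hfa.le]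
  set ζ := (l - a) / (l + conj a) with hζ
  have hla := hne l a hl.le ha
  have hlapos : 0 < ‖l + conj a‖ := norm_pos_iff.2 hla
  have hζ1 : ‖ζ‖ < 1 := by
    rw [hζ, norm_div, div_lt_one hlapos]
    refine lt_of_pow_lt_pow_left₀ 2 hlapos.le ?_
    rw [hid]
    nlinarith [mul_pos hl ha]
  have hψζ : ψ ζ = l := by
    have h1 := h1ne ζ (by simpa using hζ1)
    have haa : a + conj a ≠ 0 := hne a a ha.le ha
    simp only [hψ]
    rw [div_eq_iff h1, hζ]
    field_simp
    ring
  have hsch := Complex.norm_le_norm_of_mapsTo_ball hhd hmaps (by simp [hh, hψ]) hζ1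
  have hFpos : 0 < ‖f l + conj (f a)‖ := norm_pos_iff.2 (hne _ _ (hf l hl) hfa)
  have hhζ : h ζ = (f l - f a) / (f l + conj (f a)) := by simp only [hh]; rw [hψζ]
  rw [hhζ, hζ, norm_div, norm_div] at hsch
  rw [div_le_div_iff₀ hFpos hlapos] at hsch
  have hsq : ‖f l - f a‖ ^ 2 * ‖l + conj a‖ ^ 2 ≤ ‖l - a‖ ^ 2 * ‖f l + conj (f a)‖ ^ 2 := by
    rw [← mul_pow, ← mul_pow]
    exact pow_le_pow_left₀ (by positivity) hsch 2
  have hF := hid (f l) (f a)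
  have hL := hid l a
  have hre : (f a).re ^ 2 ≤ ‖f l + conj (f a)‖ ^ 2 := by
    rw [← Complex.normSq_eq_norm_sq, Complex.normSq_apply]
    simp
    nlinarith [hf l hl, sq_nonneg ((f l).im - (f a).im)]
  have h5 : l.re * a.re * (f a).re ^ 2 ≤ l.re * a.re * ‖f l + conj (f a)‖ ^ 2 :=
    mul_le_mul_of_nonneg_left hre (by positivity)
  refine le_of_mul_le_mul_right ?_ hfa
  -- With `hid`, the Schwarz bound becomes `Re l * Re a * ‖f l + conj (f a)‖² ≤ Re (f l) * Re (f a)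
  -- * ‖l + conj a‖²`; by `hre` one factor `Re (f a)` cancels.
  have h6 : ‖f l - f a‖ ^ 2 = ‖f l + conj (f a)‖ ^ 2 - 4 * (f l).re * (f a).re := by linarith
  have h7 : ‖l - a‖ ^ 2 = ‖l + conj a‖ ^ 2 - 4 * l.re * a.re := by linarith
  rw [h6, h7] at hsq
  nlinarith [hsq, h5]

end Harnack

/-! ### Strictly positive real edges -/

section Edge

variable {n p : Type*} [Fintype n] [DecidableEq n] [Fintype p] [DecidableEq p]

omit [DecidableEq p] in
theorem differentiableAt_transferFunction (A : Matrix n n ℝ) (B : Matrix n p ℝ)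
    (C : Matrix p n ℝ) (s : p → ℂ) {l : ℂ} (hl : l ∉ (cpx A).charpoly.roots) :
    DifferentiableAt ℂ (fun l => star s ⬝ᵥ transferFunction A B C l *ᵥ s) l := by
  let _ := Matrix.linftyOpNormedRing (n := n) (α := ℂ)
  let _ := Matrix.linftyOpNormedAlgebra (n := n) (α := ℂ) (R := ℂ)
  have hdet : IsUnit (l • (1 : Matrix n n ℂ) - cpx A) := by
    rw [isUnit_iff_isUnit_det, det_smul_one_sub, isUnit_iff_ne_zero]
    intro h0
    exact hl ((Polynomial.mem_roots (cpx A).charpoly_monic.ne_zero).2 h0)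
  have h1 : DifferentiableAt ℂ (fun l : ℂ => (l • (1 : Matrix n n ℂ) - cpx A)⁻¹) l := by
    simp_rw [nonsing_inv_eq_ringInverse]
    exact (differentiableAt_inverse (𝕜 := ℂ) hdet).comp l
      ((differentiableAt_id.smul_const _).sub_const _)
  let φ : Matrix n n ℂ →ₗ[ℂ] ℂ :=
    { toFun := fun X => star s ⬝ᵥ (cpx C * X * cpx B) *ᵥ s
      map_add' := fun X Y => by simp [Matrix.mul_add, Matrix.add_mul, add_mulVec]
      map_smul' := fun c X => by simp [smul_mulVec] }
  exact (φ.toContinuousLinearMap.differentiableAt).comp l h1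

/-- The point is that `c` does not depend on `l`. Harnack's inequality, started from a point where
the Hermitian part is definite, lets `Re (s* w)` decay no faster than `‖s‖² / (1 + ‖l‖)²`. The
resolvent bound makes `‖w‖²` at most of this same order. The bound by `‖s‖²` also yields the second
clause. -/
theorem IsStrictlyPositiveReal.exists_output_strict_passive {E : Matrix n n ℝ} {F : Matrix n p ℝ}
    {G : Matrix p n ℝ} (h : IsStrictlyPositiveReal E F G) :
    ∃ c : ℝ, 0 < c ∧ ∀ l : ℂ, 0 ≤ l.re → ∀ z s, l • z - cpx E *ᵥ z = cpx F *ᵥ s →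
      c * ‖cpx G *ᵥ z‖ ^ 2 ≤ (star s ⬝ᵥ cpx G *ᵥ z).re ∧
      ((star s ⬝ᵥ cpx G *ᵥ z).re ≤ 0 → s = 0) := by
  obtain ⟨δ, hδ, hroots, hpsd, a, ha, hdet⟩ := h
  set T : ℂ → Matrix p p ℂ := fun l => transferFunction E F G (l - δ) with hT
  have hpd := (hpsd a ha).posDef_iff_det_ne_zero.2 hdet
  obtain ⟨c, hc, hlow⟩ := PosDef.exists_norm_sq_le hpd
  obtain ⟨K, hK, hres⟩ := exists_resolvent_bound (cpx E) fun l hl =>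
    (hroots l hl).trans_lt (neg_lt_zero.2 hδ)
  obtain ⟨f, hf, hFle⟩ := exists_norm_mulVec_le (cpx F)
  obtain ⟨g, hg, hGle⟩ := exists_norm_mulVec_le (cpx G)
  have hherm : ∀ (l : ℂ) (s : p → ℂ), (star s ⬝ᵥ (T l + (T l)ᴴ) *ᵥ s).re =
      2 * (star s ⬝ᵥ T l *ᵥ s).re := by
    intro l s
    have : star s ⬝ᵥ (T l)ᴴ *ᵥ s = star (star s ⬝ᵥ T l *ᵥ s) := by
      rw [star_dotProduct, star_mulVec, conjTranspose_conjTranspose, ← dotProduct_mulVec]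
    rw [add_mulVec, dotProduct_add, this]
    simp
    ring
  have hroot : ∀ l : ℂ, 0 < l.re → l - δ ∉ (cpx E).charpoly.roots := fun l hl hmem => by
    have := hroots _ hmem
    simp at this
    linarith
  have harnack : ∀ (l : ℂ) (s : p → ℂ), 0 < l.re →
      l.re * a.re * (star s ⬝ᵥ T a *ᵥ s).re ≤
        (star s ⬝ᵥ T l *ᵥ s).re * ‖l + (starRingEnd ℂ) a‖ ^ 2 := by
    intro l s hl
    refine re_mul_re_le_of_re_nonneg (f := fun l => star s ⬝ᵥ T l *ᵥ s) ?_ ?_ ha hl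
    · intro l hl
      exact ((differentiableAt_transferFunction E F G s (hroot l hl)).comp l
        (differentiableAt_id.sub_const _)).differentiableWithinAt
    · intro l hl
      have := (hpsd l hl).re_dotProduct_nonneg s
      have h2 := hherm l s
      simp only [hT] at h2 ⊢
      simp only [RCLike.re_eq_complex_re] at this
      linarith
  -- `b` serves `‖l + δ + conj a‖ ≤ b (1 + ‖l‖)`, and `k` serves `(1 + ‖l‖) ‖w‖ ≤ k ‖s‖`.
  set b : ℝ := 1 + δ + ‖a‖ with hb
  set k : ℝ := g * K * f with hk
  have hbound : ∀ l : ℂ, 0 ≤ l.re → ∀ z s, l • z - cpx E *ᵥ z = cpx F *ᵥ s →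
      δ * a.re * c * ‖s‖ ^ 2 ≤ 2 * (star s ⬝ᵥ cpx G *ᵥ z).re * (b * (1 + ‖l‖)) ^ 2 := by
    intro l hl z s hz
    -- `T (l + δ)` is the unshifted transfer function at `l`. The shift places even imaginary `l` at
    -- distance at least `δ` inside the half-plane where `T` is positive real.
    have hlδ : 0 < (l + δ).re := by simp; linarith
    have hTs : T (l + δ) *ᵥ s = cpx G *ᵥ z := by
      have hl' : l ∉ (cpx E).charpoly.roots := by simpa using hroot (l + δ) hlδ
      simp only [hT, transferFunction, add_sub_cancel_right]
      rw [← mulVec_mulVec, ← mulVec_mulVec, mulVec_inv_eq_of_resolvent _ hl' hz]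
    have h1 := harnack (l + δ) s hlδ
    have h2 := hlow s
    rw [hherm] at h2
    rw [hTs] at h1
    have h3 : 0 ≤ (star s ⬝ᵥ cpx G *ᵥ z).re := by
      have h4 := (hpsd (l + δ) hlδ).re_dotProduct_nonneg s
      have h5 := hherm (l + δ) s
      rw [hTs] at h5
      simp only [hT] at h5
      simp only [RCLike.re_eq_complex_re] at h4
      linarith
    have h6 : ‖l + δ + (starRingEnd ℂ) a‖ ≤ b * (1 + ‖l‖) := by
      have h7 := norm_add_le (l + δ) ((starRingEnd ℂ) a)
      have h8 := norm_add_le l (δ : ℂ)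
      rw [RCLike.norm_conj] at h7
      rw [Complex.norm_real, Real.norm_of_nonneg hδ.le] at h8
      rw [hb]
      nlinarith [norm_nonneg l, norm_nonneg a, mul_nonneg hδ.le (norm_nonneg l),
        mul_nonneg (norm_nonneg a) (norm_nonneg l)]
    have h9 : ‖l + δ + (starRingEnd ℂ) a‖ ^ 2 ≤ (b * (1 + ‖l‖)) ^ 2 :=
      pow_le_pow_left₀ (norm_nonneg _) h6 2
    have h10 : δ ≤ (l + δ).re := by simpa using hl
    calc δ * a.re * c * ‖s‖ ^ 2 = δ * a.re * (c * ‖s‖ ^ 2) := by ring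
      _ ≤ δ * a.re * (2 * (star s ⬝ᵥ T a *ᵥ s).re) := by gcongr
      _ ≤ (l + δ).re * a.re * (2 * (star s ⬝ᵥ T a *ᵥ s).re) := by
        have : 0 ≤ 2 * (star s ⬝ᵥ T a *ᵥ s).re := le_trans (by positivity) h2
        gcongr
      _ ≤ 2 * (star s ⬝ᵥ cpx G *ᵥ z).re * ‖l + δ + (starRingEnd ℂ) a‖ ^ 2 := by linarith
      _ ≤ _ := by gcongr
  have hbpos : 0 < b := by rw [hb]; positivity
  have hkpos : 0 ≤ k := by rw [hk]; positivity
  -- The factors `(1 + ‖l‖)²` from the two bounds cancel; the `+ 1` only keeps the denominator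
  -- positive.
  refine ⟨δ * a.re * c / (2 * (k * b) ^ 2 + 1), by positivity, fun l hl z s hz => ⟨?_, ?_⟩⟩
  · have h1 := hbound l hl z s hz
    have hl1 : 0 < 1 + ‖l‖ := by positivity
    have h3 : 0 ≤ (star s ⬝ᵥ cpx G *ᵥ z).re := by
      by_contra hneg
      push Not at hneg
      have : 0 < (b * (1 + ‖l‖)) ^ 2 := by positivity
      have h4 : 0 ≤ δ * a.re * c * ‖s‖ ^ 2 := by positivity
      nlinarith
    have h2 : (1 + ‖l‖) * ‖cpx G *ᵥ z‖ ≤ k * ‖s‖ := by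
      have h4 := hres l hl z
      rw [hz] at h4
      calc (1 + ‖l‖) * ‖cpx G *ᵥ z‖ ≤ (1 + ‖l‖) * (g * ‖z‖) := by gcongr; exact hGle z
        _ = g * ((1 + ‖l‖) * ‖z‖) := by ring
        _ ≤ g * (K * ‖cpx F *ᵥ s‖) := by gcongr
        _ ≤ g * (K * (f * ‖s‖)) := by gcongr; exact hFle s
        _ = k * ‖s‖ := by rw [hk]; ring
    have h5 : ((1 + ‖l‖) * ‖cpx G *ᵥ z‖) ^ 2 ≤ (k * ‖s‖) ^ 2 :=
      pow_le_pow_left₀ (by positivity) h2 2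
    rw [div_mul_eq_mul_div, div_le_iff₀ (by positivity)]
    refine le_of_mul_le_mul_right ?_ (pow_pos hl1 2)
    calc δ * a.re * c * ‖cpx G *ᵥ z‖ ^ 2 * (1 + ‖l‖) ^ 2
        = δ * a.re * c * ((1 + ‖l‖) * ‖cpx G *ᵥ z‖) ^ 2 := by ring
      _ ≤ δ * a.re * c * (k * ‖s‖) ^ 2 := by gcongr
      _ = k ^ 2 * (δ * a.re * c * ‖s‖ ^ 2) := by ring
      _ ≤ k ^ 2 * (2 * (star s ⬝ᵥ cpx G *ᵥ z).re * (b * (1 + ‖l‖)) ^ 2) := by gcongr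
      _ = (star s ⬝ᵥ cpx G *ᵥ z).re * (2 * (k * b) ^ 2) * (1 + ‖l‖) ^ 2 := by ring
      _ ≤ _ := by gcongr; linarith
  · intro hle
    have h1 := hbound l hl z s hz
    have h2 : 2 * (star s ⬝ᵥ cpx G *ᵥ z).re * (b * (1 + ‖l‖)) ^ 2 ≤ 0 :=
      mul_nonpos_of_nonpos_of_nonneg (by linarith) (by positivity)
    have h3 : 0 < δ * a.re * c := by positivity
    have h4 : ‖s‖ ^ 2 ≤ 0 := by
      by_contra hs
      push Not at hs
      nlinarith [mul_pos h3 hs]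
    exact norm_eq_zero.1 (pow_eq_zero_iff (two_ne_zero) |>.1 (le_antisymm h4 (by positivity)))

end Edge

/-! ### Complexification of real matrices -/

section Complexification

variable {l m n : Type*} [Fintype m]

theorem cpx_mul (A : Matrix l m ℝ) (B : Matrix m n ℝ) : cpx (A * B) = cpx A * cpx B :=
  Matrix.map_mul (f := Complex.ofRealHom)

omit [Fintype m] in
theorem cpx_one [DecidableEq m] : cpx (1 : Matrix m m ℝ) = 1 :=
  Matrix.map_one _ Complex.ofReal_zero Complex.ofReal_one

omit [Fintype m] in
theorem cpx_transpose (A : Matrix l m ℝ) : cpx Aᵀ = (cpx A)ᴴ := by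
  ext; simp

theorem map_cpx_mulVec (φ : ℂ →L[ℝ] ℝ) (A : Matrix l m ℝ) (x : m → ℂ) (i : l) :
    φ ((cpx A *ᵥ x) i) = (A *ᵥ fun k => φ (x k)) i := by
  simp only [mulVec, dotProduct, map_sum, map_apply]
  refine Finset.sum_congr rfl fun k _ => ?_
  rw [← Complex.real_smul, map_smul, smul_eq_mul]

theorem cpx_mulVec_ofReal (A : Matrix l m ℝ) (x : m → ℝ) (i : l) :
    (cpx A *ᵥ fun k => (x k : ℂ)) i = ((A *ᵥ x) i : ℂ) := by
  simp [mulVec, dotProduct]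

-- A factorization `A = Bᵀ B` over the reals complexifies to a Gram matrix.
open scoped MatrixOrder in
theorem PosSemidef.cpx {A : Matrix m m ℝ} (hA : A.PosSemidef) : (cpx A).PosSemidef := by
  classical
  obtain ⟨B, rfl⟩ := CStarAlgebra.nonneg_iff_eq_star_mul_self.mp hA.nonneg
  rw [star_eq_conjTranspose, conjTranspose_eq_transpose_of_trivial, cpx_mul, cpx_transpose]
  exact posSemidef_conjTranspose_mul_self _

theorem PosDef.cpx [DecidableEq m] {A : Matrix m m ℝ} (hA : A.PosDef) : (cpx A).PosDef := by
  refine (PosSemidef.cpx hA.posSemidef).posDef_iff_det_ne_zero.2 ?_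
  have h := hA.det_pos.ne'
  have h2 : (DynamicEdgeNetwork.cpx A).det = (A.det : ℂ) :=
    (RingHom.map_det Complex.ofRealHom A).symm
  rw [h2]
  exact_mod_cast h

end Complexification

/-! ### Passivity in the frequency domain -/

section Passivity

variable {n p : Type*} [Fintype n] [Fintype p]

/-- Passivity in the frequency domain: on every exponential solution in the closed right
half-plane, the real part of the supplied power is nonnegative. -/
theorem IsPassive.re_nonneg {A : Matrix n n ℝ} {B : Matrix n p ℝ} {C : Matrix p n ℝ}
    (h : IsPassive A B C) {l : ℂ} (hl : 0 ≤ l.re) {ξ : n → ℂ} {v : p → ℂ}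
    (hξ : cpx A *ᵥ ξ + cpx B *ᵥ v = l • ξ) : 0 ≤ (star v ⬝ᵥ cpx C *ᵥ ξ).re := by
  obtain ⟨V, hV, hdiss⟩ := h
  have hexp : ∀ t : ℝ, HasDerivAt (fun t : ℝ => Complex.exp (l * t)) (Complex.exp (l * t) * l) t := by
    intro t
    have h1 : HasDerivAt (fun z : ℂ => Complex.exp (l * z)) (Complex.exp (l * t) * l) (t : ℂ) := by
      simpa using ((hasDerivAt_id (t : ℂ)).const_mul l).cexp
    exact h1.comp_ofReal
  -- Passivity speaks of real trajectories: `φ` is later the real or the imaginary part of the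
  -- exponential solution. Adding the two supplied powers removes the oscillation and leaves `exp (2
  -- Re l t) * r`.
  let X : (ℂ →L[ℝ] ℝ) → ℝ → n → ℝ := fun φ t k => φ (Complex.exp (l * t) * ξ k)
  let U : (ℂ →L[ℝ] ℝ) → ℝ → p → ℝ := fun φ t k => φ (Complex.exp (l * t) * v k)
  have hU : ∀ φ, Continuous (U φ) := fun φ => by fun_prop
  have hXc : ∀ φ, Continuous (X φ) := fun φ => by fun_prop
  have htraj : ∀ φ, IsStateTrajectory A B (U φ) (X φ) := by
    intro φ t _
    refine HasDerivAt.hasDerivWithinAt (hasDerivAt_pi.2 fun k => ?_)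
    have h1 := φ.hasFDerivAt.comp_hasDerivAt t ((hexp t).mul_const (ξ k))
    have h2 : (A *ᵥ X φ t + B *ᵥ U φ t) k = φ (Complex.exp (l * t) * l * ξ k) := by
      have h3 := congrArg (fun w => Complex.exp (l * t) * w) (congrFun hξ k)
      simp only [Pi.add_apply, Pi.smul_apply, smul_eq_mul] at h3
      rw [mul_assoc, ← h3, mul_add, map_add, Pi.add_apply]
      congr 1
      · rw [← smul_eq_mul, ← Pi.smul_apply, ← mulVec_smul, map_cpx_mulVec]; rfl
      · rw [← smul_eq_mul, ← Pi.smul_apply, ← mulVec_smul, map_cpx_mulVec]; rfl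
    rw [h2]
    exact h1
  set r := (star v ⬝ᵥ cpx C *ᵥ ξ).re with hr
  have hpow : ∀ t : ℝ, U Complex.reCLM t ⬝ᵥ (C *ᵥ X Complex.reCLM t) +
      U Complex.imCLM t ⬝ᵥ (C *ᵥ X Complex.imCLM t) = Real.exp (2 * l.re * t) * r := by
    intro t
    set e := Complex.exp (l * t) with he
    have hC : ∀ φ : ℂ →L[ℝ] ℝ, ∀ i, (C *ᵥ X φ t) i = φ (e * (cpx C *ᵥ ξ) i) := by
      intro φ i
      rw [← smul_eq_mul, ← Pi.smul_apply, ← mulVec_smul, map_cpx_mulVec]; rfl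
    have hnorm : Real.exp (2 * l.re * t) = e.re * e.re + e.im * e.im := by
      rw [← Complex.normSq_apply, Complex.normSq_eq_norm_sq, he, Complex.norm_exp, ← Real.exp_nat_mul]
      congr 1
      simp
      ring
    simp only [hr, dotProduct, hC, U, ← he, ← Finset.sum_add_distrib, Complex.re_sum,
      Finset.mul_sum, hnorm]
    refine Finset.sum_congr rfl fun i _ => ?_
    simp
    ring
  by_contra hneg
  push Not at hneg
  set V0 := V (X Complex.reCLM 0) + V (X Complex.imCLM 0) with hV0
  have hV0n : 0 ≤ V0 := add_nonneg (hV _) (hV _)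
  -- If `r < 0`, at most `T * r` is supplied up to time `T`. This `T` makes that `-(V0 + 1)`, more
  -- than the initial storage can cover.
  set T := (V0 + 1) / (-r) with hT
  have hTpos : 0 < T := div_pos (by linarith) (by linarith)
  have h1 := hdiss _ _ (hU Complex.reCLM) (htraj _) T hTpos.le
  have h2 := hdiss _ _ (hU Complex.imCLM) (htraj _) T hTpos.le
  have hint : ∀ φ, IntervalIntegrable (fun t => U φ t ⬝ᵥ (C *ᵥ X φ t)) MeasureTheory.volume 0 T := by
    intro φ
    have := hU φ
    have := hXc φ
    apply Continuous.intervalIntegrable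
    fun_prop
  have h3 := intervalIntegral.integral_add (hint Complex.reCLM) (hint Complex.imCLM)
  simp_rw [hpow] at h3
  have h4 : ∫ t in (0 : ℝ)..T, Real.exp (2 * l.re * t) * r ≤ ∫ _ in (0 : ℝ)..T, r := by
    refine intervalIntegral.integral_mono_on hTpos.le
      (Continuous.intervalIntegrable (by fun_prop) _ _) (by simp) fun t ht => ?_
    have : 1 ≤ Real.exp (2 * l.re * t) := Real.one_le_exp (by have := ht.1; positivity)
    nlinarith
  rw [intervalIntegral.integral_const, smul_eq_mul, sub_zero] at h4
  have h5 : T * r = -(V0 + 1) := by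
    rw [hT, div_neg, neg_mul, div_mul_cancel₀ _ hneg.ne]
  have h6 := hV (X Complex.reCLM T)
  have h7 := hV (X Complex.imCLM T)
  linarith

end Passivity

/-! ### Internal models and the Sylvester equation -/

section InternalModel

variable {q : ℕ}

/-- Simple roots make the characteristic polynomial squarefree, so `S` is diagonalizable over `ℂ`
and its eigenvectors span. -/
theorem HasSimpleImaginarySpectrum.eq_zero_of_eigenvectors {n W : Type*} [Fintype n]
    [DecidableEq n] [AddCommGroup W] [Module ℂ W] {S : Matrix n n ℝ}
    (hS : HasSimpleImaginarySpectrum S) (f : (n → ℂ) →ₗ[ℂ] W)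
    (hf : ∀ (l : ℂ) (φ : n → ℂ), φ ≠ 0 → cpx S *ᵥ φ = l • φ → f φ = 0) : f = 0 := by
  have hsq : Squarefree (cpx S).charpoly := by
    refine Polynomial.Separable.squarefree ?_
    rw [← Polynomial.nodup_roots_iff_of_splits (cpx S).charpoly_monic.ne_zero
      (IsAlgClosed.splits _), Multiset.nodup_iff_count_le_one]
    intro l
    by_cases hl : l ∈ (cpx S).charpoly.roots
    · rw [Polynomial.count_roots, hS.2 l hl]
    · rw [Multiset.count_eq_zero_of_notMem hl]; exact zero_le_one
  have hss : Module.End.IsSemisimple (toLin' (cpx S)) := by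
    refine Module.End.isSemisimple_of_squarefree_aeval_eq_zero hsq ?_
    rw [← charpoly_toLin']
    exact LinearMap.aeval_self_charpoly _
  have htop := hss.iSup_eigenspace_eq_top
  refine LinearMap.ext fun x => ?_
  have hx : x ∈ ⨆ μ : ℂ, Module.End.eigenspace (toLin' (cpx S)) μ := by rw [htop]; trivial
  induction hx using Submodule.iSup_induction' with
  | zero => simp
  | add x y _ _ hx hy => simp [hx, hy]
  | mem l x hx =>
    rcases eq_or_ne x 0 with rfl | h0
    · simp
    · exact hf l x h0 (by simpa using Module.End.mem_eigenspace_iff.1 hx)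

/-- Pairing with a left eigenvector `ψ` at `l` removes `y` and leaves `(ψ ⬝ b) c = 0`. If `ψ ⬝ b =
0`, then `ψ` annihilates every `a ^ k b`, against controllability. -/
theorem IsControllablePair.eq_zero_of_resonance {d : ℕ} {a : Matrix (Fin d) (Fin d) ℝ}
    {b : Fin d → ℝ} (h : IsControllablePair a b) {l : ℂ} (hl : l ∈ (cpx a).charpoly.roots)
    {y : Fin d → ℂ} {c : ℂ} (hy : ∀ i, (cpx a *ᵥ y) i + b i * c = l * y i) : c = 0 := by
  obtain ⟨ψ, hψ, hψa⟩ := exists_vecMul_eq_zero_iff.2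
    ((det_smul_one_sub (cpx a) l).trans (Polynomial.isRoot_of_mem_roots hl))
  have hleft : ψ ᵥ* cpx a = l • ψ := by
    rw [vecMul_sub, vecMul_smul, vecMul_one, sub_eq_zero] at hψa
    exact hψa.symm
  have h0 : (ψ ⬝ᵥ fun i => (b i : ℂ)) * c = 0 := by
    have h1 : cpx a *ᵥ y + c • (fun i => (b i : ℂ)) = l • y := by
      ext i; simpa [mul_comm c] using hy i
    have h2 := congrArg (fun w => ψ ⬝ᵥ w) h1
    simp only [dotProduct_add, dotProduct_mulVec, hleft, smul_dotProduct, dotProduct_smul,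
      smul_eq_mul] at h2
    linear_combination h2
  refine (mul_eq_zero.1 h0).resolve_left fun hb => hψ ?_
  -- Controllability is a span over `ℝ`, so `ψ` is used as a real-linear map on real vectors.
  let f : (Fin d → ℝ) →ₗ[ℝ] ℂ :=
    { toFun := fun x => ψ ⬝ᵥ fun i => (x i : ℂ)
      map_add' := fun x y => by simp [dotProduct, mul_add, Finset.sum_add_distrib]
      map_smul' := fun r x => by simp [dotProduct, Finset.mul_sum, mul_left_comm] }
  have hmul : ∀ x, f (a *ᵥ x) = l * f x := by
    intro x
    have h1 : (fun i => ((a *ᵥ x) i : ℂ)) = cpx a *ᵥ fun i => (x i : ℂ) := by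
      ext i; rw [cpx_mulVec_ofReal]
    change (ψ ⬝ᵥ fun i => ((a *ᵥ x) i : ℂ)) = _
    rw [h1, dotProduct_mulVec, hleft, smul_dotProduct]
    rfl
  have hpow : ∀ k : ℕ, f ((a ^ k) *ᵥ b) = 0 := by
    intro k
    induction k with
    | zero => rw [pow_zero, one_mulVec]; exact hb
    | succ k ih => rw [pow_succ', ← mulVec_mulVec, hmul, ih, mul_zero]
  have hker : LinearMap.ker f = ⊤ := by
    rw [eq_top_iff, ← h, Submodule.span_le]
    rintro _ ⟨k, rfl⟩
    exact hpow k
  ext i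
  have : f (Pi.single i 1) = 0 := LinearMap.congr_fun (LinearMap.ker_eq_top.1 hker) _
  simpa [f, dotProduct, Pi.single_apply, apply_ite Complex.ofReal] using this

/-- An internal model blocks the eigenmodes of the exosystem from its input. -/
theorem IncorporatesInternalModel.eq_zero_of_eigenvector {c p : ℕ} {S : Matrix (Fin q) (Fin q) ℝ}
    {G₁ : Matrix (Fin c) (Fin c) ℝ} {G₂ : Matrix (Fin c) (Fin p) ℝ}
    (h : IncorporatesInternalModel S G₁ G₂) {l : ℂ} {φ : Fin q → ℂ} (hφ : φ ≠ 0)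
    (hSφ : cpx S *ᵥ φ = l • φ) {y : Fin c → ℂ} {e : Fin p → ℂ}
    (hy : cpx G₁ *ᵥ y + cpx G₂ *ᵥ e = l • y) : e = 0 := by
  obtain ⟨r, d, α, β, S₁, S₂, S₃, T, Tinv, -, hTinv, hG₁, hG₂', hk⟩ := h
  obtain ⟨R, hR⟩ : ∃ R : Matrix (Fin r ⊕ Σ k, Fin (d k)) (Fin p) ℝ, R = Matrix.fromRows S₃
    (Matrix.of fun a k => if a.1 = k then β a.1 a.2 else 0) := ⟨_, rfl⟩
  have hG₂ : G₂ = T * R := by rw [hR]; exact hG₂'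
  have hTinv' : cpx Tinv * cpx T = 1 := by rw [← cpx_mul, hTinv, cpx_one]
  set y' := cpx Tinv *ᵥ y with hy'
  have h1 := congrArg (fun w => cpx Tinv *ᵥ w) hy
  rw [hG₁, hG₂, cpx_mul, cpx_mul, cpx_mul] at h1
  simp only [mulVec_add, mulVec_smul, ← mulVec_mulVec] at h1
  simp only [mulVec_mulVec _ (cpx Tinv) (cpx T), hTinv', one_mulVec, ← hy'] at h1
  ext k
  -- An eigenvalue of `S` is a root of its minimal polynomial, which divides the characteristic
  -- polynomial of `α k`.
  have hroot : l ∈ (cpx (α k)).charpoly.roots := by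
    have hmin : Polynomial.aeval l (minpoly ℝ S) = 0 := by
      have h2 : ∀ P : Polynomial ℝ,
          cpx (Polynomial.aeval S P) *ᵥ φ = Polynomial.aeval l P • φ := by
        intro P
        induction P using Polynomial.induction_on' with
        | add P Q hP hQ =>
          have : cpx (Polynomial.aeval S P + Polynomial.aeval S Q) =
            cpx (Polynomial.aeval S P) + cpx (Polynomial.aeval S Q) := by ext; simp
          rw [map_add, map_add, this, add_mulVec, hP, hQ, add_smul]
        | monomial n a =>
          have h3 : ∀ n : ℕ, cpx (S ^ n) *ᵥ φ = l ^ n • φ := by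
            intro n
            induction n with
            | zero => simp
            | succ n ih =>
              rw [pow_succ, cpx_mul, ← mulVec_mulVec, hSφ, mulVec_smul, ih, smul_smul, pow_succ']
          have h4 : cpx (a • S ^ n) = (a : ℂ) • cpx (S ^ n) := by ext; simp
          rw [Polynomial.aeval_monomial, Polynomial.aeval_monomial, ← Algebra.smul_def, h4,
            smul_mulVec, h3, smul_smul]
          rfl
      have h5 := h2 (minpoly ℝ S)
      rw [minpoly.aeval] at h5
      have h6 : cpx (0 : Matrix (Fin q) (Fin q) ℝ) = 0 := by ext; simp
      rw [h6, zero_mulVec] at h5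
      exact (smul_eq_zero.1 h5.symm).resolve_right hφ
    obtain ⟨R, hR⟩ := (hk k).2
    rw [Polynomial.mem_roots (charpoly_monic _).ne_zero]
    have h7 : (cpx (α k)).charpoly = (α k).charpoly.map Complex.ofRealHom :=
      charpoly_map (α k) Complex.ofRealHom
    have h8 : Polynomial.eval₂ Complex.ofRealHom l (minpoly ℝ S) = 0 := hmin
    rw [Polynomial.IsRoot.def, h7, Polynomial.eval_map, hR, Polynomial.eval₂_mul, h8, zero_mul]
  refine (hk k).1.eq_zero_of_resonance hroot (y := fun a => y' (Sum.inr ⟨k, a⟩)) fun a => ?_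
  have h9 := congrFun h1 (Sum.inr ⟨k, a⟩)
  simp only [Pi.add_apply, Pi.smul_apply, smul_eq_mul] at h9
  rw [← h9]
  congr 1
  · simp only [mulVec, dotProduct, map_apply, Fintype.sum_sum_type, fromBlocks_apply₂₁,
      fromBlocks_apply₂₂, Matrix.zero_apply, Complex.ofReal_zero, zero_mul, Finset.sum_const_zero, zero_add,
      Fintype.sum_sigma]
    rw [Finset.sum_eq_single k]
    · simp [blockDiagonal'_apply]
    · intro k' _ hk'
      refine Finset.sum_eq_zero fun b _ => ?_
      rw [blockDiagonal'_apply_ne _ _ _ hk'.symm]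
      simp
    · simp
  · simp [hR, mulVec, dotProduct, apply_ite Complex.ofReal]

/-- The Sylvester equation, when the right coefficient is diagonalizable. -/
theorem HasSimpleImaginarySpectrum.exists_sylvester {n : Type*} [Fintype n] [DecidableEq n]
    {S : Matrix (Fin q) (Fin q) ℝ} (hS : HasSimpleImaginarySpectrum S) {A : Matrix n n ℝ}
    (hA : IsHurwitz A) (R : Matrix n (Fin q) ℂ) :
    ∃ X : Matrix n (Fin q) ℂ, cpx A * X - X * cpx S = R := by
  let Φ : Matrix n (Fin q) ℂ →ₗ[ℂ] Matrix n (Fin q) ℂ :=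
    { toFun := fun X => cpx A * X - X * cpx S
      map_add' := fun X Y => by rw [Matrix.mul_add, Matrix.add_mul]; abel
      map_smul' := fun c X => by simp [smul_sub] }
  -- A kernel element intertwines `S` with `A`, so it would carry an eigenvector with imaginary
  -- eigenvalue to one of the Hurwitz matrix `A`, unless it kills it.
  have hinj : Function.Injective Φ := by
    rw [← LinearMap.ker_eq_bot, LinearMap.ker_eq_bot']
    intro X hX
    have hX : cpx A * X = X * cpx S := sub_eq_zero.1 hX
    have h0 : X.mulVecLin = 0 := hS.eq_zero_of_eigenvectors _ fun l φ hφ hSφ => by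
      by_contra hne
      have h1 : cpx A *ᵥ (X *ᵥ φ) = l • (X *ᵥ φ) := by
        rw [mulVec_mulVec, hX, ← mulVec_mulVec, hSφ, mulVec_smul]
      have h2 := hA l ((mem_roots_charpoly_iff _ _).2 ⟨_, hne, h1⟩)
      have h3 := hS.1 l ((mem_roots_charpoly_iff _ _).2 ⟨φ, hφ, hSφ⟩)
      linarith
    ext i j
    have := congrFun (LinearMap.congr_fun h0 (Pi.single j 1)) i
    simpa using this
  exact LinearMap.surjective_of_injective hinj R

end InternalModel

/-! ### Passivity of the exosystem -/

section Exosystem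

variable {q p : Type*} [Fintype q] [DecidableEq q] [Fintype p]

theorem star_dotProduct_conjTranspose_mulVec {m n : Type*} [Fintype m] [Fintype n]
    (A : Matrix m n ℂ) (x : n → ℂ) (y : m → ℂ) :
    star x ⬝ᵥ Aᴴ *ᵥ y = star (A *ᵥ x) ⬝ᵥ y := by
  rw [star_mulVec, dotProduct_mulVec]

omit [DecidableEq q] [Fintype q] in
theorem PosDef.isSymm {P : Matrix q q ℝ} (hP : P.PosDef) : P.IsSymm :=
  (conjTranspose_eq_transpose_of_trivial P).symm.trans hP.isHermitian

theorem star_dotProduct_comm {n : Type*} [Fintype n] (x y : n → ℂ) :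
    star x ⬝ᵥ y = star (star y ⬝ᵥ x) :=
  star_dotProduct x y

omit [DecidableEq q] in
theorem star_dotProduct_lyapunov {P S : Matrix q q ℝ} (hP : P.IsSymm) (η : q → ℂ) :
    star η ⬝ᵥ cpx (P * S + Sᵀ * P) *ᵥ η =
      star η ⬝ᵥ cpx P *ᵥ (cpx S *ᵥ η) + star (star η ⬝ᵥ cpx P *ᵥ (cpx S *ᵥ η)) := by
  have h1 : cpx (P * S + Sᵀ * P) = cpx P * cpx S + (cpx S)ᴴ * (cpx P)ᴴ := by
    rw [← cpx_transpose, ← cpx_transpose, hP, ← cpx_mul, ← cpx_mul]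
    ext; simp
  rw [h1, add_mulVec, dotProduct_add, ← mulVec_mulVec, ← mulVec_mulVec,
    star_dotProduct_conjTranspose_mulVec, star_dotProduct_conjTranspose_mulVec,
    star_dotProduct_comm (cpx P *ᵥ _)]

/-- The exosystem can only dissipate energy in an exponential mode of the closed right
half-plane. -/
theorem re_star_dotProduct_lyapunov_nonneg {P S : Matrix q q ℝ} (hP : P.PosDef)
    (hPS : (-(P * S + Sᵀ * P)).PosSemidef) {l : ℂ} (hl : 0 ≤ l.re) (η : q → ℂ) :
    0 ≤ (star η ⬝ᵥ cpx P *ᵥ (l • η - cpx S *ᵥ η)).re := by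
  have h1 := (PosSemidef.cpx hPS).dotProduct_mulVec_nonneg η
  have h2 : cpx (-(P * S + Sᵀ * P)) = -cpx (P * S + Sᵀ * P) := by ext; simp
  rw [h2, neg_mulVec, dotProduct_neg, star_dotProduct_lyapunov (PosDef.isSymm hP)] at h1
  have h3 := (Complex.nonneg_iff.1 h1).1
  have h4 := Complex.nonneg_iff.1 ((PosDef.cpx hP).posSemidef.dotProduct_mulVec_nonneg η)
  rw [mulVec_sub, dotProduct_sub, mulVec_smul, dotProduct_smul, smul_eq_mul, Complex.sub_re,
    Complex.mul_re, ← h4.2, mul_zero, sub_zero]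
  simp only [Complex.neg_re, Complex.add_re, Complex.star_def, Complex.conj_re] at h3
  nlinarith [mul_nonneg hl h4.1]

/-- The gain `P⁻¹ Qᵀ` cancels the weight `P`: power entering the exosystem, measured by `P`, is `v`
paired with the output `Q η`. -/
theorem star_dotProduct_input {P : Matrix q q ℝ} (hP : P.PosDef) (Q : Matrix p q ℝ) (η : q → ℂ)
    (v : p → ℂ) :
    star η ⬝ᵥ cpx P *ᵥ (cpx (P⁻¹ * Qᵀ) *ᵥ v) = star (cpx Q *ᵥ η) ⬝ᵥ v := by
  rw [mulVec_mulVec, ← cpx_mul, ← Matrix.mul_assoc, mul_nonsing_inv _ ((isUnit_iff_isUnit_det P).1 hP.isUnit),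
    Matrix.one_mul, cpx_transpose, star_dotProduct_conjTranspose_mulVec]

/-- Eigenvectors of the exosystem are orthogonal, with respect to `P`, to the range of
`S - l`. -/
theorem star_dotProduct_eq_zero_of_eigenvector {P S : Matrix q q ℝ} (hP : P.PosDef)
    (hPS : (-(P * S + Sᵀ * P)).PosSemidef) {l : ℂ} (hl : l.re = 0) {φ : q → ℂ}
    (hφ : cpx S *ᵥ φ = l • φ) (η : q → ℂ) :
    star φ ⬝ᵥ cpx P *ᵥ (cpx S *ᵥ η - l • η) = 0 := by
  have hconj : star l = -l := by
    apply Complex.ext <;> simp [hl]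
  have hPherm : (cpx P)ᴴ = cpx P := (PosDef.cpx hP).isHermitian
  have hPreal : star (star φ ⬝ᵥ cpx P *ᵥ φ) = star φ ⬝ᵥ cpx P *ᵥ φ := by
    rw [← star_dotProduct_comm, ← star_dotProduct_conjTranspose_mulVec, hPherm]
  have h2 : cpx (-(P * S + Sᵀ * P)) = -cpx (P * S + Sᵀ * P) := by ext; simp
  -- The form at `φ` is `-2 Re l * φ* P φ = 0`, and a semidefinite form vanishes only on its kernel.
  -- Hence `P φ` is an eigenvector of `Sᴴ` for `-l`, if nonzero.
  have h3 : cpx (-(P * S + Sᵀ * P)) *ᵥ φ = 0 := by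
    rw [← (PosSemidef.cpx hPS).dotProduct_mulVec_zero_iff, h2, neg_mulVec, dotProduct_neg,
      star_dotProduct_lyapunov (PosDef.isSymm hP), hφ, mulVec_smul, dotProduct_smul, smul_eq_mul,
      star_mul', hPreal, hconj]
    ring
  have h4 : cpx (P * S + Sᵀ * P) = (cpx P) * cpx S + (cpx S)ᴴ * cpx P := by
    rw [← cpx_transpose, ← cpx_mul, ← cpx_mul]
    ext; simp
  have h5 : (cpx S)ᴴ *ᵥ (cpx P *ᵥ φ) = -(l • cpx P *ᵥ φ) := by
    rw [h2, neg_mulVec, neg_eq_zero, h4, add_mulVec, ← mulVec_mulVec, ← mulVec_mulVec, hφ,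
      mulVec_smul] at h3
    exact (neg_eq_of_add_eq_zero_right h3).symm
  have h6 : ∀ w, star φ ⬝ᵥ cpx P *ᵥ w = star (cpx P *ᵥ φ) ⬝ᵥ w := fun w => by
    rw [← star_dotProduct_conjTranspose_mulVec, hPherm]
  rw [h6, dotProduct_sub, ← conjTranspose_conjTranspose (cpx S),
    star_dotProduct_conjTranspose_mulVec, h5, star_neg, star_smul, hconj]
  simp

end Exosystem

/-! ### Regulator equations and the node bound -/

section Node

variable {N M p q : ℕ} {sys : MultiAgentSystem N M p} (K : ControllerGains sys) (i : Fin N)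

theorem cpx_Chat_mulVec (ξ : Fin (sys.n i) ⊕ Fin (K.c i) → ℂ) :
    cpx (K.Chat i) *ᵥ ξ = cpx (sys.C i) *ᵥ (ξ ∘ Sum.inl) := by
  ext a
  simp [ControllerGains.Chat, mulVec, dotProduct]

theorem cpx_Ahat_mulVec (ξ : Fin (sys.n i) ⊕ Fin (K.c i) → ℂ) :
    cpx (K.Ahat i) *ᵥ ξ = Sum.elim
      (cpx (sys.A i + sys.B i * K.Kx i) *ᵥ (ξ ∘ Sum.inl) +
        cpx (sys.B i * K.Kζ i) *ᵥ (ξ ∘ Sum.inr))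
      (cpx (K.G₂ i) *ᵥ (cpx (sys.C i) *ᵥ (ξ ∘ Sum.inl)) + cpx (K.G₁ i) *ᵥ (ξ ∘ Sum.inr)) := by
  rw [ControllerGains.Ahat, cpx, fromBlocks_map, fromBlocks_mulVec, ← cpx, ← cpx, ← cpx, ← cpx,
    cpx_mul (K.G₂ i), mulVec_mulVec]

theorem cpx_Dhat_mulVec (v : Fin p → ℂ) :
    cpx (K.Dhat i) *ᵥ v = Sum.elim (cpx (sys.D i) *ᵥ v) 0 := by
  ext a
  cases a <;> simp [ControllerGains.Dhat, mulVec, dotProduct]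

/-- Solvability of the regulator equations of a node with an internal model. -/
theorem exists_regulator {S : Matrix (Fin q) (Fin q) ℝ} (Q : Matrix (Fin p) (Fin q) ℝ)
    (hS : HasSimpleImaginarySpectrum S) (hIM : IncorporatesInternalModel S (K.G₁ i) (K.G₂ i))
    (hA : IsHurwitz (K.Ahat i)) :
    ∃ X : Matrix (Fin (sys.n i) ⊕ Fin (K.c i)) (Fin q) ℂ,
      (∀ η, cpx (K.Ahat i) *ᵥ (X *ᵥ η) - Sum.elim (0 : Fin (sys.n i) → ℂ) (cpx (K.G₂ i) *ᵥ (cpx Q *ᵥ η)) =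
        X *ᵥ (cpx S *ᵥ η)) ∧
      ∀ η, cpx (K.Chat i) *ᵥ (X *ᵥ η) = cpx Q *ᵥ η := by
  obtain ⟨X, hX⟩ := hS.exists_sylvester hA (fromRows 0 (cpx (K.G₂ i) * cpx Q))
  have h1 : ∀ η, cpx (K.Ahat i) *ᵥ (X *ᵥ η) - Sum.elim (0 : Fin (sys.n i) → ℂ) (cpx (K.G₂ i) *ᵥ (cpx Q *ᵥ η)) =
      X *ᵥ (cpx S *ᵥ η) := by
    intro η
    have h2 := congrArg (fun Y => Y *ᵥ η) hX
    simp only [sub_mulVec, ← mulVec_mulVec] at h2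
    rw [sub_eq_iff_eq_add, add_comm, ← sub_eq_iff_eq_add] at h2
    rw [← h2]
    congr 1
    ext a
    cases a <;> simp [mulVec, dotProduct]
  refine ⟨X, h1, fun η => ?_⟩
  have h0 : (cpx (K.Chat i) * X - cpx Q).mulVecLin = 0 :=
    -- On an eigenvector `φ`, the controller rows read as the internal model driven at resonance by
    -- `Ĉ X φ - Q φ`, which must therefore vanish.
    hS.eq_zero_of_eigenvectors _ fun l φ hφ hSφ => by
      refine hIM.eq_zero_of_eigenvector hφ hSφ (y := (X *ᵥ φ) ∘ Sum.inr) ?_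
      have h3 := h1 φ
      rw [hSφ, mulVec_smul, cpx_Ahat_mulVec] at h3
      ext a
      have h4 := congrFun h3 (Sum.inr a)
      simp only [Pi.sub_apply, Sum.elim_inr, Pi.add_apply, Pi.smul_apply] at h4
      rw [mulVecLin_apply, sub_mulVec, ← mulVec_mulVec, cpx_Chat_mulVec, mulVec_sub]
      simp only [Pi.add_apply, Pi.sub_apply, Pi.smul_apply, Function.comp_apply, ← h4]
      ring
  have h5 := LinearMap.congr_fun h0 η
  rw [mulVecLin_apply, sub_mulVec, ← mulVec_mulVec] at h5
  exact sub_eq_zero.1 h5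

/-- Each node with its exosystem is almost passive in the closed right half-plane, with a defect
proportional to the adaptation gain. -/
theorem exists_node_bound {S P : Matrix (Fin q) (Fin q) ℝ} (Q : Matrix (Fin p) (Fin q) ℝ)
    (hS : HasSimpleImaginarySpectrum S) (hIM : IncorporatesInternalModel S (K.G₁ i) (K.G₂ i))
    (hA : IsHurwitz (K.Ahat i)) (hpass : IsPassive (K.Ahat i) (K.Dhat i) (K.Chat i))
    (hP : P.PosDef) (hPS : (-(P * S + Sᵀ * P)).PosSemidef) :
    ∃ (c : ℝ) (X : Matrix (Fin (sys.n i) ⊕ Fin (K.c i)) (Fin q) ℂ), 0 ≤ c ∧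
      ∀ (ε : ℝ) (l : ℂ) (ξ : Fin (sys.n i) ⊕ Fin (K.c i) → ℂ) (η : Fin q → ℂ) (v : Fin p → ℂ),
        0 < ε → 0 ≤ l.re →
        cpx (K.Ahat i) *ᵥ ξ + cpx (K.Dhat i) *ᵥ v - Sum.elim (0 : Fin (sys.n i) → ℂ) (cpx (K.G₂ i) *ᵥ (cpx Q *ᵥ η)) =
          l • ξ →
        cpx S *ᵥ η + (ε : ℂ) • cpx (P⁻¹ * Qᵀ) *ᵥ v = l • η →
        -(ε * c * ‖v‖ ^ 2) ≤ (star v ⬝ᵥ cpx (K.Chat i) *ᵥ ξ).re ∧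
        (v = 0 → ξ = X *ᵥ η ∧ cpx (K.Chat i) *ᵥ ξ = cpx Q *ᵥ η) := by
  obtain ⟨X, hX, hXC⟩ := exists_regulator K i Q hS hIM hA
  obtain ⟨k, hk, hres⟩ := exists_resolvent_bound (cpx (K.Ahat i)) hA
  obtain ⟨b, hb, hble⟩ := exists_norm_mulVec_le (X * cpx (P⁻¹ * Qᵀ))
  obtain ⟨g, hg, hgle⟩ := exists_norm_mulVec_le (cpx (K.Chat i))
  refine ⟨p * (g * (k * b)), X, by positivity, fun ε l ξ η v hε hl hξ hη => ?_⟩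
  have hroot : l ∉ (cpx (K.Ahat i)).charpoly.roots := fun h => absurd hl (not_le.2 (hA l h))
  obtain ⟨ξa, hξa⟩ := exists_resolvent_apply (cpx (K.Ahat i)) hroot (cpx (K.Dhat i) *ᵥ v)
  -- `ξa` is the passive response to `v`, and `X η` is the regulated part with output `Q η`. The
  -- remainder `e` is driven only by `-ε X Bη v`, since `η` departs from the autonomous exosystem by
  -- `ε Bη v`.
  set e := ξ - ξa - X *ᵥ η with he
  have hdecomp : ξ = ξa + e + X *ᵥ η := by rw [he]; abel
  have hee : l • e - cpx (K.Ahat i) *ᵥ e = -((ε : ℂ) • (X * cpx (P⁻¹ * Qᵀ)) *ᵥ v) := by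
    have h1 := hX η
    have h2 := congrArg (fun w => X *ᵥ w) hη
    simp only [mulVec_add, mulVec_smul, mulVec_mulVec] at h2 h1
    simp only [he, mulVec_sub, smul_sub, ← hξ, mulVec_mulVec, ← h2]
    rw [← h1, ← hξa]
    abel
  have hpa := hpass.re_nonneg hl (ξ := ξa) (v := v) (by rw [← hξa]; abel)
  have hexo : 0 ≤ (star v ⬝ᵥ cpx Q *ᵥ η).re := by
    have h1 := re_star_dotProduct_lyapunov_nonneg hP hPS hl η
    have h2 : l • η - cpx S *ᵥ η = (ε : ℂ) • cpx (P⁻¹ * Qᵀ) *ᵥ v := by rw [← hη]; abel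
    rw [h2, mulVec_smul, dotProduct_smul, star_dotProduct_input hP, smul_eq_mul,
      Complex.re_ofReal_mul, star_dotProduct_comm, Complex.star_def, Complex.conj_re] at h1
    exact nonneg_of_mul_nonneg_right h1 hε
  have hebound : ‖e‖ ≤ k * (ε * (b * ‖v‖)) := by
    have h1 := hres l hl e
    rw [hee, norm_neg, norm_smul, Complex.norm_real, Real.norm_of_nonneg hε.le] at h1
    calc ‖e‖ ≤ (1 + ‖l‖) * ‖e‖ := by nlinarith [norm_nonneg l, norm_nonneg e]
      _ ≤ k * (ε * ‖(X * cpx (P⁻¹ * Qᵀ)) *ᵥ v‖) := h1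
      _ ≤ k * (ε * (b * ‖v‖)) := by gcongr; exact hble v
  constructor
  · rw [hdecomp, mulVec_add, mulVec_add, dotProduct_add, dotProduct_add, hXC, Complex.add_re,
      Complex.add_re]
    have h1 : ‖star v ⬝ᵥ cpx (K.Chat i) *ᵥ e‖ ≤ ε * (p * (g * (k * b))) * ‖v‖ ^ 2 := by
      calc ‖star v ⬝ᵥ cpx (K.Chat i) *ᵥ e‖ ≤ p * ‖v‖ * ‖cpx (K.Chat i) *ᵥ e‖ := by
            simpa using norm_star_dotProduct_le v (cpx (K.Chat i) *ᵥ e)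
        _ ≤ p * ‖v‖ * (g * (k * (ε * (b * ‖v‖)))) := by
            gcongr; exact (hgle e).trans (by gcongr)
        _ = _ := by ring
    have h2 := (abs_le.1 ((Complex.abs_re_le_norm _).trans h1)).1
    linarith
  · rintro rfl
    have he0 : e = 0 := by
      rw [norm_zero, mul_zero, mul_zero, mul_zero] at hebound
      exact norm_le_zero_iff.1 hebound
    have ha0 : ξa = 0 := by
      have h1 := hres l hl ξa
      rw [hξa, mulVec_zero, norm_zero, mul_zero] at h1
      refine norm_le_zero_iff.1 ?_
      nlinarith [norm_nonneg l, norm_nonneg ξa, mul_nonneg (norm_nonneg l) (norm_nonneg ξa)]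
    have h1 : ξ = X *ᵥ η := by rw [hdecomp, he0, ha0]; simp
    exact ⟨h1, by rw [h1, hXC]⟩

end Node

/-! ### Incidence matrix, consensus and power balance -/

section Network

variable {N M p : ℕ} (sys : MultiAgentSystem N M p)

theorem sum_H (j : Fin M) : ∑ i, sys.H i j = 0 := by
  have h : ∀ i, sys.H i j =
      (if i = sys.pos j then 1 else 0) + (if i = sys.neg j then -1 else 0) := by
    intro i
    have := sys.pos_ne_neg j
    simp only [MultiAgentSystem.H, of_apply]
    split_ifs with h1 h2
    · exact absurd (h1.symm.trans h2) this
    all_goals simp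
  simp [h, Finset.sum_add_distrib]

theorem abs_H_le (i : Fin N) (j : Fin M) : |sys.H i j| ≤ 1 := by
  simp only [MultiAgentSystem.H, of_apply]
  split_ifs <;> simp

/-- By rank-nullity the kernel of `Hᵀ` is a line, and it contains the all-ones vector. -/
theorem IsConnected.consensus_real {sys : MultiAgentSystem N M p} (h : sys.IsConnected)
    {g : Fin N → ℝ} (hg : ∀ j, ∑ i, sys.H i j * g i = 0) (i k : Fin N) : g i = g k := by
  have hker : ∀ w, w ∈ LinearMap.ker (sys.Hᵀ).mulVecLin ↔ ∀ j, ∑ i, sys.H i j * w i = 0 := by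
    intro w
    rw [LinearMap.mem_ker, funext_iff]
    rfl
  have hrank : Module.finrank ℝ (LinearMap.ker (sys.Hᵀ).mulVecLin) = 1 := by
    have h1 := LinearMap.finrank_range_add_finrank_ker (sys.Hᵀ).mulVecLin
    have h2 : Module.finrank ℝ (LinearMap.range (sys.Hᵀ).mulVecLin) = sys.H.rank := by
      rw [← rank_transpose]; rfl
    have h3 : sys.H.rank + 1 = N := h
    rw [h2, Module.finrank_fin_fun] at h1
    omega
  let one : LinearMap.ker (sys.Hᵀ).mulVecLin := ⟨1, (hker 1).2 fun j => by simpa using sum_H sys j⟩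
  have hone : one ≠ 0 := fun h0 => by
    have := congrFun (congrArg Subtype.val h0) i
    simp [one] at this
  obtain ⟨c, hc⟩ := (finrank_eq_one_iff_of_nonzero' one hone).1 hrank ⟨g, (hker g).2 hg⟩
  have hc' : ∀ i, c = g i := fun i => by
    simpa [one] using congrFun (congrArg Subtype.val hc) i
  rw [← hc', ← hc']

theorem IsConnected.consensus {sys : MultiAgentSystem N M p} (h : sys.IsConnected)
    {y : Fin N → Fin p → ℂ} (hy : ∀ j, ∑ i, (sys.H i j : ℂ) • y i = 0) (i k : Fin N) :
    y i = y k := by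
  have key : ∀ (φ : ℂ →L[ℝ] ℝ) (a : Fin p), φ (y i a) = φ (y k a) := fun φ a =>
    IsConnected.consensus_real h (g := fun i => φ (y i a)) (fun j => by
      have h1 := congrArg φ (congrFun (hy j) a)
      simp only [Finset.sum_apply, map_sum, Pi.smul_apply, Pi.zero_apply, map_zero] at h1
      rw [← h1]
      refine Finset.sum_congr rfl fun i _ => ?_
      rw [smul_eq_mul, ← Complex.real_smul, map_smul, smul_eq_mul]) i k
  ext a
  exact Complex.ext (key Complex.reCLM a) (key Complex.imCLM a)

/-- Entries of `H` have modulus at most one; Cauchy–Schwarz gives the factor `M`, summation over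
nodes the factor `N`. -/
theorem sum_norm_input_sq_le (w : Fin M → Fin p → ℂ) :
    ∑ i, ‖-∑ j, (sys.H i j : ℂ) • w j‖ ^ 2 ≤ N * M * ∑ j, ‖w j‖ ^ 2 := by
  have h1 : ∀ i ∈ Finset.univ, ‖-∑ j, (sys.H i j : ℂ) • w j‖ ^ 2 ≤ M * ∑ j, ‖w j‖ ^ 2 := by
    intro i _
    have h2 : ‖-∑ j, (sys.H i j : ℂ) • w j‖ ≤ ∑ j, ‖w j‖ := by
      rw [norm_neg]
      refine (norm_sum_le _ _).trans (Finset.sum_le_sum fun j _ => ?_)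
      rw [norm_smul, Complex.norm_real, Real.norm_eq_abs]
      exact mul_le_of_le_one_left (norm_nonneg _) (abs_H_le sys i j)
    refine (pow_le_pow_left₀ (norm_nonneg _) h2 2).trans ?_
    simpa using sq_sum_le_card_mul_sum_sq (s := Finset.univ) (f := fun j => ‖w j‖)
  refine (Finset.sum_le_sum h1).trans ?_
  simp [mul_assoc]

/-- The interconnection preserves power. -/
theorem sum_star_edge_input (y : Fin N → Fin p → ℂ) (w : Fin M → Fin p → ℂ) :
    ∑ j, (star (∑ i, (sys.H i j : ℂ) • y i) ⬝ᵥ w j).re =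
      -∑ i, (star (-∑ j, (sys.H i j : ℂ) • w j) ⬝ᵥ y i).re := by
  simp only [star_neg, star_sum, star_smul, sum_dotProduct, neg_dotProduct, smul_dotProduct,
    Complex.re_sum, Complex.neg_re, Finset.sum_neg_distrib, neg_neg, Complex.star_def,
    Complex.conj_ofReal, smul_eq_mul, Complex.re_ofReal_mul]
  rw [Finset.sum_comm]
  refine Finset.sum_congr rfl fun i _ => Finset.sum_congr rfl fun j _ => ?_
  rw [star_dotProduct_comm (y i), Complex.star_def, Complex.conj_re]

end Network

/-! ### Modes of the closed loop -/

section ClosedLoop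

variable {N M p q : ℕ} {sys : MultiAgentSystem N M p} (K : ControllerGains sys)

/-- The complexified state space of the closed loop: the states `(x i, ζ i)`, `z j` and `η i`. -/
abbrev ModalState (q : ℕ) : Type :=
  (∀ i, Fin (sys.n i) ⊕ Fin (K.c i) → ℂ) × (∀ j, Fin (sys.ne j) → ℂ) × (Fin N → Fin q → ℂ)

/-- The output `y i`. -/
noncomputable def modalOutput (i : Fin N) : ModalState K q →ₗ[ℂ] Fin p → ℂ :=
  (cpx (K.Chat i)).mulVecLin ∘ₗ LinearMap.proj i ∘ₗ LinearMap.fst ℂ _ _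

/-- The neighboring input `v i`. -/
noncomputable def modalNodeInput (i : Fin N) : ModalState K q →ₗ[ℂ] Fin p → ℂ :=
  -∑ j, (sys.H i j : ℂ) •
    ((cpx (sys.G j)).mulVecLin ∘ₗ LinearMap.proj j ∘ₗ LinearMap.fst ℂ _ _ ∘ₗ LinearMap.snd ℂ _ _)

/-- The edge input `s j`. -/
noncomputable def modalEdgeInput (j : Fin M) : ModalState K q →ₗ[ℂ] Fin p → ℂ :=
  ∑ i, (sys.H i j : ℂ) • modalOutput K i

variable {K}

theorem modalOutput_apply (i : Fin N) (X : ModalState K q) :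
    modalOutput K i X = cpx (K.Chat i) *ᵥ X.1 i := rfl

theorem modalNodeInput_apply (i : Fin N) (X : ModalState K q) :
    modalNodeInput K i X = -∑ j, (sys.H i j : ℂ) • cpx (sys.G j) *ᵥ X.2.1 j := by
  simp [modalNodeInput]

theorem modalEdgeInput_apply (j : Fin M) (X : ModalState K q) :
    modalEdgeInput K j X = ∑ i, (sys.H i j : ℂ) • modalOutput K i X := by
  simp [modalEdgeInput]

variable (K) (S : Matrix (Fin q) (Fin q) ℝ) (Bη : Matrix (Fin q) (Fin p) ℝ)
  (Q : Matrix (Fin p) (Fin q) ℝ) (ε : ℝ)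

/-- The linear vector field of the closed loop. -/
noncomputable def generator : ModalState K q →L[ℂ] ModalState K q :=
  LinearMap.toContinuousLinearMap
    { toFun := fun X =>
        (fun i => cpx (K.Ahat i) *ᵥ X.1 i + cpx (K.Dhat i) *ᵥ modalNodeInput K i X -
            Sum.elim (0 : Fin (sys.n i) → ℂ) (cpx (K.G₂ i) *ᵥ (cpx Q *ᵥ X.2.2 i)),
          fun j => cpx (sys.E j) *ᵥ X.2.1 j + cpx (sys.F j) *ᵥ modalEdgeInput K j X,
          fun i => cpx S *ᵥ X.2.2 i + (ε : ℂ) • cpx Bη *ᵥ modalNodeInput K i X)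
      map_add' := fun X Y => by
        refine Prod.ext ?_ (Prod.ext ?_ ?_)
        · funext i a
          rcases a with a | a <;> simp [mulVec_add] <;> ring
        · funext i
          simp [mulVec_add]
          abel
        · funext i
          simp [mulVec_add]
          abel
      map_smul' := fun r X => by
        refine Prod.ext ?_ (Prod.ext ?_ ?_)
        · funext i a
          rcases a with a | a <;> simp [mulVec_smul] <;> ring
        · funext i
          simp [mulVec_smul]
        · funext i
          simp [mulVec_smul, smul_comm r] }

theorem generator_fst (X : ModalState K q) (i : Fin N) : (generator K S Bη Q ε X).1 i =
    cpx (K.Ahat i) *ᵥ X.1 i + cpx (K.Dhat i) *ᵥ modalNodeInput K i X -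
      Sum.elim (0 : Fin (sys.n i) → ℂ) (cpx (K.G₂ i) *ᵥ (cpx Q *ᵥ X.2.2 i)) := rfl

theorem generator_snd_fst (X : ModalState K q) (j : Fin M) : (generator K S Bη Q ε X).2.1 j =
    cpx (sys.E j) *ᵥ X.2.1 j + cpx (sys.F j) *ᵥ modalEdgeInput K j X := rfl

theorem generator_snd_snd (X : ModalState K q) (i : Fin N) : (generator K S Bη Q ε X).2.2 i =
    cpx S *ᵥ X.2.2 i + (ε : ℂ) • cpx Bη *ᵥ modalNodeInput K i X := rfl

/-- The modes of the closed loop in the closed right half-plane, for small adaptation gain: the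
edges are at rest and the node outputs agree with the exosystem outputs and with one another. -/
theorem exists_gain_unstable_modes (P : Matrix (Fin q) (Fin q) ℝ)
    (hA2 : HasSimpleImaginarySpectrum S)
    (hA3 : ∀ j, IsStrictlyPositiveReal (sys.E j) (sys.F j) (sys.G j))
    (hA4 : sys.IsConnected)
    (hIM : ∀ i, IncorporatesInternalModel S (K.G₁ i) (K.G₂ i))
    (hA5 : ∀ i, IsHurwitz (K.Ahat i) ∧ IsPassive (K.Ahat i) (K.Dhat i) (K.Chat i))
    (hP : P.PosDef) (hPS : (-(P * S + Sᵀ * P)).PosSemidef) (hBη : Bη = P⁻¹ * Qᵀ) :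
    ∃ εstar : ℝ, 0 < εstar ∧ ∀ ε : ℝ, 0 < ε → ε < εstar →
      ∀ l : ℂ, 0 ≤ l.re → ∀ X : ModalState K q, generator K S Bη Q ε X = l • X →
        (X.2.2 = 0 → X = 0) ∧
        (∀ i, cpx S *ᵥ X.2.2 i = l • X.2.2 i) ∧
        (∀ i, modalOutput K i X = cpx Q *ᵥ X.2.2 i) ∧
        ∀ i k, modalOutput K i X = modalOutput K k X := by
  choose c hc hedge using fun j => (hA3 j).exists_output_strict_passive
  choose b R hb hnode using fun i =>
    exists_node_bound K i Q hA2 (hIM i) (hA5 i).1 (hA5 i).2 hP hPS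
  -- A common positive lower bound of the `c j`, taken near zero so that `M = 0` needs no separate
  -- case.
  obtain ⟨c₀, hc₀⟩ := (eventually_all.2 fun j => Ioc_mem_nhdsGT (hc j) :
    ∀ᶠ c₀ in 𝓝[>] (0 : ℝ), ∀ j, c₀ ∈ Ioc 0 (c j)).and self_mem_nhdsWithin |>.exists
  have hc₀pos : 0 < c₀ := hc₀.2
  set b₀ := ∑ i, b i with hb₀
  have hb₀n : 0 ≤ b₀ := Finset.sum_nonneg fun i _ => hb i
  have hble : ∀ i, b i ≤ b₀ := fun i => Finset.single_le_sum (fun i _ => hb i) (Finset.mem_univ i)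
  -- This threshold yields `ε b₀ N M < c₀`, so the defect of the nodes cannot balance the
  -- dissipation of the edges.
  refine ⟨c₀ / (b₀ * (N * M) + 1), by positivity, fun ε hε hεs l hl X hX => ?_⟩
  rw [lt_div_iff₀ (by positivity)] at hεs
  have hX1 := fun i => congrFun (congrArg Prod.fst hX) i
  have hX2 := fun j => congrFun (congrArg (fun Y => Y.2.1) hX) j
  have hX3 := fun i => congrFun (congrArg (fun Y => Y.2.2) hX) i
  simp only [generator_fst, generator_snd_fst, generator_snd_snd, hBη] at hX1 hX2 hX3
  have hn := fun i => hnode i ε l (X.1 i) (X.2.2 i) (modalNodeInput K i X) hε hl (hX1 i) (hX3 i)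
  have he := fun j => hedge j l hl (X.2.1 j) (modalEdgeInput K j X) (by
    have h1 : _ = l • X.2.1 j := hX2 j
    rw [← h1]; abel)
  set W := ∑ j, ‖cpx (sys.G j) *ᵥ X.2.1 j‖ ^ 2 with hW
  have hW0 : 0 ≤ W := by positivity
  have hVW : ∑ i, ‖modalNodeInput K i X‖ ^ 2 ≤ N * M * W := by
    simp only [modalNodeInput_apply]
    exact sum_norm_input_sq_le sys _
  have hpower : ∑ j, (star (modalEdgeInput K j X) ⬝ᵥ cpx (sys.G j) *ᵥ X.2.1 j).re =
      -∑ i, (star (modalNodeInput K i X) ⬝ᵥ modalOutput K i X).re := by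
    simp only [modalNodeInput_apply, modalEdgeInput_apply]
    exact sum_star_edge_input sys _ _
  have h1 : c₀ * W ≤ ∑ j, (star (modalEdgeInput K j X) ⬝ᵥ cpx (sys.G j) *ᵥ X.2.1 j).re := by
    rw [hW, Finset.mul_sum]
    refine Finset.sum_le_sum fun j _ => le_trans ?_ (he j).1
    exact mul_le_mul_of_nonneg_right (hc₀.1 j).2 (by positivity)
  have h2 : -(ε * b₀ * (N * M * W)) ≤
      ∑ i, (star (modalNodeInput K i X) ⬝ᵥ modalOutput K i X).re := by
    have h3 : ε * b₀ * ∑ i, ‖modalNodeInput K i X‖ ^ 2 ≤ ε * b₀ * (N * M * W) := by gcongr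
    refine (neg_le_neg h3).trans ?_
    rw [Finset.mul_sum, ← Finset.sum_neg_distrib]
    refine Finset.sum_le_sum fun i _ => le_trans (neg_le_neg ?_) (hn i).1
    gcongr
    exact hble i
  -- The power balance reads `c₀ W ≤ ε b₀ N M W`.
  have hW00 : W = 0 := by
    by_contra hne
    have hWpos : 0 < W := lt_of_le_of_ne hW0 (Ne.symm hne)
    nlinarith [mul_lt_mul_of_pos_right hεs hWpos, mul_pos hε hWpos]
  have hw : ∀ j, cpx (sys.G j) *ᵥ X.2.1 j = 0 := fun j => by
    have := (Finset.sum_eq_zero_iff_of_nonneg fun j _ => by positivity).1 hW00 j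
      (Finset.mem_univ j)
    exact norm_eq_zero.1 (pow_eq_zero_iff two_ne_zero |>.1 this)
  have hv : ∀ i, modalNodeInput K i X = 0 := fun i => by simp [modalNodeInput_apply, hw]
  -- With `w j = 0` the edge receives no power, and strictness then excludes a nonzero `s j`.
  have hs : ∀ j, modalEdgeInput K j X = 0 := fun j => (he j).2 (by rw [hw j]; simp)
  refine ⟨fun h0 => ?_, fun i => ?_, fun i => ((hn i).2 (hv i)).2, ?_⟩
  · refine Prod.ext ?_ (Prod.ext ?_ h0)
    · funext i
      rw [((hn i).2 (hv i)).1, h0]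
      simp
    · funext j
      by_contra hz
      obtain ⟨δ, hδ, hroot, -⟩ := hA3 j
      have h3 := hX2 j
      rw [hs j, mulVec_zero, add_zero] at h3
      have h4 := hroot l ((mem_roots_charpoly_iff _ _).2 ⟨X.2.1 j, hz, h3⟩)
      linarith
  · have h3 := hX3 i
    rw [hv i, mulVec_zero, smul_zero, add_zero] at h3
    exact h3
  · exact IsConnected.consensus hA4 fun j => by rw [← modalEdgeInput_apply, hs j]

/-- Each column of `H` sums to zero. This drives both semisimplicity and the autonomy of the
averaged exosystem. -/
theorem sum_modalNodeInput (X : ModalState K q) : ∑ i, modalNodeInput K i X = 0 := by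
  simp only [modalNodeInput_apply, Finset.sum_neg_distrib]
  rw [Finset.sum_comm]
  simp only [← Finset.sum_smul]
  have : ∀ j, ∑ i, (sys.H i j : ℂ) = 0 := fun j => by exact_mod_cast sum_H sys j
  simp [this]

/-- Pair the exosystem rows of the chain with the eigenvectors `η i` of `Y` in the weight `P`. The
range of `S - l` drops out, leaving `ε` times the common output of `Y` against `v i`. The sum over
`i` vanishes, so positivity of `P` kills every `η i`, and with them `Y`. -/
theorem unstable_modes_semisimple {S} {Bη} {Q} {ε} {P : Matrix (Fin q) (Fin q) ℝ}
    (hA2 : HasSimpleImaginarySpectrum S)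
    (hP : P.PosDef) (hPS : (-(P * S + Sᵀ * P)).PosSemidef) (hBη : Bη = P⁻¹ * Qᵀ)
    {l : ℂ} {X Y : ModalState K q} (hY0 : Y.2.2 = 0 → Y = 0)
    (hYS : ∀ i, cpx S *ᵥ Y.2.2 i = l • Y.2.2 i)
    (hYQ : ∀ i, modalOutput K i Y = cpx Q *ᵥ Y.2.2 i)
    (hYc : ∀ i k, modalOutput K i Y = modalOutput K k Y)
    (hX : generator K S Bη Q ε X = l • X + Y) : Y = 0 := by
  refine hY0 ?_
  by_cases hl : l.re = 0
  · have hterm : ∀ i, star (Y.2.2 i) ⬝ᵥ cpx P *ᵥ Y.2.2 i =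
        ε * (star (modalOutput K i Y) ⬝ᵥ modalNodeInput K i X) := by
      intro i
      have h1 : cpx S *ᵥ X.2.2 i + (ε : ℂ) • cpx Bη *ᵥ modalNodeInput K i X =
        l • X.2.2 i + Y.2.2 i := congrFun (congrArg (fun Y => Y.2.2) hX) i
      have h2 : Y.2.2 i = (cpx S *ᵥ X.2.2 i - l • X.2.2 i) +
          (ε : ℂ) • cpx Bη *ᵥ modalNodeInput K i X := by
        rw [sub_add_eq_add_sub, h1]; abel
      have h3 := congrArg (fun w => star (Y.2.2 i) ⬝ᵥ cpx P *ᵥ w) h2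
      simp only [mulVec_add, dotProduct_add, mulVec_smul, dotProduct_smul, hBη,
        star_dotProduct_input hP, star_dotProduct_eq_zero_of_eigenvector hP hPS hl (hYS i),
        zero_add, smul_eq_mul] at h3
      rw [h3, hYQ]
    have hsum : ∑ i, star (Y.2.2 i) ⬝ᵥ cpx P *ᵥ Y.2.2 i = 0 := by
      rcases isEmpty_or_nonempty (Fin N) with hN | ⟨⟨k⟩⟩
      · simp
      · simp only [hterm, fun i => hYc i k]
        rw [← Finset.mul_sum, ← dotProduct_sum, sum_modalNodeInput, dotProduct_zero, mul_zero]
    have hpos := fun i => (PosDef.cpx hP).posSemidef.dotProduct_mulVec_nonneg (Y.2.2 i)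
    funext i
    have h0 := (Finset.sum_eq_zero_iff_of_nonneg fun i _ => hpos i).1 hsum i (Finset.mem_univ i)
    by_contra hne
    exact ((PosDef.cpx hP).dotProduct_mulVec_pos hne).ne' h0
  · funext i
    by_contra hne
    exact hl (hA2.1 l ((mem_roots_charpoly_iff _ _).2 ⟨_, hne, hYS i⟩))

/-- The difference between the output of node `i` and the output of the averaged exosystem. -/
noncomputable def syncError (i : Fin N) : ModalState K q →ₗ[ℂ] Fin p → ℂ :=
  modalOutput K i - (cpx Q).mulVecLin ∘ₗ ((N : ℂ)⁻¹ •
    ∑ k, LinearMap.proj k ∘ₗ LinearMap.snd ℂ _ _ ∘ₗ LinearMap.snd ℂ _ _)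

theorem syncError_apply (i : Fin N) (X : ModalState K q) : syncError K Q i X =
    modalOutput K i X - cpx Q *ᵥ ((N : ℂ)⁻¹ • ∑ k, X.2.2 k) := by
  simp [syncError, mulVec_smul, mulVec_sum]

/-- The `Q (η k)` all equal the common output, hence so does their average. -/
theorem syncError_eq_zero {X : ModalState K q}
    (hQ : ∀ i, modalOutput K i X = cpx Q *ᵥ X.2.2 i)
    (hc : ∀ i k, modalOutput K i X = modalOutput K k X) (i : Fin N) :
    syncError K Q i X = 0 := by
  have hN : (N : ℂ) ≠ 0 := by have := i.pos; exact_mod_cast this.ne'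
  rw [syncError_apply, mulVec_smul, mulVec_sum]
  simp only [← hQ, fun k => hc k i]
  rw [Finset.sum_const, Finset.card_univ, Fintype.card_fin, ← Nat.cast_smul_eq_nsmul ℂ, smul_smul,
    inv_mul_cancel₀ hN, one_smul, sub_self]

end ClosedLoop

/-! ### Real trajectories and nontriviality -/

section Trajectories

theorem cpx_mulVec_ofReal_fun {m n : Type*} [Fintype n] (A : Matrix m n ℝ) (x : n → ℝ) :
    (cpx A *ᵥ fun k => (x k : ℂ)) = fun i => ((A *ᵥ x) i : ℂ) :=
  funext fun i => cpx_mulVec_ofReal A x i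

variable {N M p q : ℕ} {sys : MultiAgentSystem N M p} {K : ControllerGains sys}
  {S : Matrix (Fin q) (Fin q) ℝ} {Bη : Matrix (Fin q) (Fin p) ℝ}
  {Q : Matrix (Fin p) (Fin q) ℝ} {ε : ℝ}

/-- The complexified state of a solution. -/
noncomputable def Signals.modalState (σ : Signals K q) (t : ℝ) : ModalState K q :=
  (fun i => Sum.elim (fun a => (σ.x i t a : ℂ)) fun a => (σ.ζ i t a : ℂ),
    fun j a => (σ.z j t a : ℂ), fun i a => (σ.η i t a : ℂ))

namespace IsClosedLoopSolution

variable {σ : Signals K q} (h : IsClosedLoopSolution K S Bη Q ε σ) {t : ℝ} (ht : 0 ≤ t)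

include h ht

theorem modalOutput_modalState (i : Fin N) :
    modalOutput K i (σ.modalState t) = fun a => (σ.y i t a : ℂ) := by
  rw [modalOutput_apply, cpx_Chat_mulVec, h.node_output i t ht]
  exact cpx_mulVec_ofReal_fun _ _

theorem modalNodeInput_modalState (i : Fin N) :
    modalNodeInput K i (σ.modalState t) = fun a => (σ.v i t a : ℂ) := by
  rw [modalNodeInput_apply, h.neighboring_input i t ht]
  funext a
  simp only [Signals.modalState, cpx_mulVec_ofReal_fun, h.edge_output _ t ht]
  simp

theorem modalEdgeInput_modalState (j : Fin M) :
    modalEdgeInput K j (σ.modalState t) = fun a => (σ.s j t a : ℂ) := by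
  rw [modalEdgeInput_apply, h.edge_input j t ht]
  funext a
  simp only [h.modalOutput_modalState ht]
  simp

theorem hasDerivWithinAt_modalState :
    HasDerivWithinAt σ.modalState (generator K S Bη Q ε (σ.modalState t)) (Ici 0) t := by
  have hcoe : ∀ {n : ℕ} {x : ℝ → Fin n → ℝ} {x' : Fin n → ℝ} {w : ℂ} (a : Fin n),
      HasDerivWithinAt x x' (Ici 0) t → w = x' a →
        HasDerivWithinAt (fun t => (x t a : ℂ)) w (Ici 0) t := by
    rintro n x x' w a hx rfl
    exact (hasDerivWithinAt_pi.1 hx a).ofReal_comp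
  refine HasDerivWithinAt.prodMk ?_ (HasDerivWithinAt.prodMk ?_ ?_)
  · refine hasDerivWithinAt_pi.2 fun i => hasDerivWithinAt_pi.2 fun a => ?_
    rw [h.modalNodeInput_modalState ht, cpx_Ahat_mulVec, cpx_Dhat_mulVec]
    have e1 : (σ.modalState t).1 i ∘ Sum.inl = fun a => (σ.x i t a : ℂ) := rfl
    have e2 : (σ.modalState t).1 i ∘ Sum.inr = fun a => (σ.ζ i t a : ℂ) := rfl
    have e3 : (σ.modalState t).2.2 i = fun a => (σ.η i t a : ℂ) := rfl
    rw [e1, e2, e3]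
    simp only [cpx_mulVec_ofReal_fun]
    rcases a with a | a
    · refine hcoe a (h.node_state i t ht) ?_
      simp [h.control_law i t ht, add_mulVec, mulVec_add]
      ring
    · refine hcoe a (h.controller_state i t ht) ?_
      simp [h.node_output i t ht, mulVec_sub]
      ring
  · refine hasDerivWithinAt_pi.2 fun j => hasDerivWithinAt_pi.2 fun a => ?_
    rw [h.modalEdgeInput_modalState ht]
    have e1 : (σ.modalState t).2.1 j = fun a => (σ.z j t a : ℂ) := rfl
    rw [e1]
    simp only [cpx_mulVec_ofReal_fun]
    refine hcoe a (h.edge_state j t ht) ?_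
    simp
  · refine hasDerivWithinAt_pi.2 fun i => hasDerivWithinAt_pi.2 fun a => ?_
    rw [h.modalNodeInput_modalState ht]
    have e1 : (σ.modalState t).2.2 i = fun a => (σ.η i t a : ℂ) := rfl
    rw [e1]
    simp only [cpx_mulVec_ofReal_fun]
    refine hcoe a (h.exosystem i t ht) ?_
    simp

omit ht

theorem sum_neighboring_input (ht : 0 ≤ t) : ∑ i, σ.v i t = 0 := by
  have h1 := sum_modalNodeInput K (σ.modalState t)
  simp only [h.modalNodeInput_modalState ht] at h1
  funext a
  have h2 := congrFun h1 a
  simp only [Finset.sum_apply, Pi.zero_apply] at h2 ⊢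
  exact_mod_cast h2

/-- The averaged exosystem state evolves autonomously. -/
theorem average_exosystem (ht : 0 ≤ t) : (N : ℝ)⁻¹ • ∑ k, σ.η k t =
    NormedSpace.exp (t • S) *ᵥ ((N : ℝ)⁻¹ • ∑ k, σ.η k 0) := by
  refine eq_exp_smul_mulVec S (fun t => (N : ℝ)⁻¹ • ∑ k, σ.η k t) (fun t ht => ?_) t ht
  have h1 := (HasDerivWithinAt.fun_sum fun k (_ : k ∈ Finset.univ) => h.exosystem k t ht).const_smul
    (N : ℝ)⁻¹
  refine h1.congr_deriv ?_
  rw [Finset.sum_add_distrib, ← Finset.smul_sum, ← mulVec_sum, ← mulVec_sum,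
    h.sum_neighboring_input ht, mulVec_zero, smul_zero, add_zero, mulVec_smul]

theorem syncError_modalState (ht : 0 ≤ t) (i : Fin N) :
    syncError K Q i (σ.modalState t) = fun a => ((σ.y i t -
      Q *ᵥ (NormedSpace.exp (t • S) *ᵥ ((N : ℝ)⁻¹ • ∑ k, σ.η k 0))) a : ℂ) := by
  have h1 : (N : ℂ)⁻¹ • ∑ k, (σ.modalState t).2.2 k =
      fun a => (((N : ℝ)⁻¹ • ∑ k, σ.η k t) a : ℂ) := by
    funext a
    simp [Signals.modalState]
  rw [syncError_apply, h.modalOutput_modalState ht, h1, h.average_exosystem ht,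
    cpx_mulVec_ofReal_fun]
  funext a
  simp

end IsClosedLoopSolution

/-- The signals of the real part of a complex solution of the closed loop. -/
noncomputable def realSignals (X : ℝ → ModalState K q) : Signals K q where
  x i t a := ((X t).1 i (Sum.inl a)).re
  u i t := K.Kx i *ᵥ (fun a => ((X t).1 i (Sum.inl a)).re) +
    K.Kζ i *ᵥ fun a => ((X t).1 i (Sum.inr a)).re
  v i t a := (modalNodeInput K i (X t) a).re
  y i t a := (modalOutput K i (X t) a).re
  z j t a := ((X t).2.1 j a).re
  s j t a := (modalEdgeInput K j (X t) a).re
  w j t a := ((cpx (sys.G j) *ᵥ (X t).2.1 j) a).re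
  η i t a := ((X t).2.2 i a).re
  ζ i t a := ((X t).1 i (Sum.inr a)).re

theorem re_cpx_mulVec {m n : Type*} [Fintype n] (A : Matrix m n ℝ) (x : n → ℂ) (i : m) :
    ((cpx A *ᵥ x) i).re = (A *ᵥ fun k => (x k).re) i :=
  map_cpx_mulVec Complex.reCLM A x i

/-- All coefficient matrices are real, so taking real parts commutes with the vector field. -/
theorem isClosedLoopSolution_realSignals {X : ℝ → ModalState K q}
    (hX : ∀ t, HasDerivAt X (generator K S Bη Q ε (X t)) t) :
    IsClosedLoopSolution K S Bη Q ε (realSignals X) := by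
  have h1 : ∀ t i a, HasDerivAt (fun t => ((X t).1 i a).re)
      ((generator K S Bη Q ε (X t)).1 i a).re t := fun t i a =>
    Complex.reCLM.hasFDerivAt.comp_hasDerivAt t
      (hasDerivAt_pi.1 (hasDerivAt_pi.1 (hX t).fst i) a)
  have h2 : ∀ t j a, HasDerivAt (fun t => ((X t).2.1 j a).re)
      ((generator K S Bη Q ε (X t)).2.1 j a).re t := fun t j a =>
    Complex.reCLM.hasFDerivAt.comp_hasDerivAt t
      (hasDerivAt_pi.1 (hasDerivAt_pi.1 (hX t).snd.fst j) a)
  have h3 : ∀ t i a, HasDerivAt (fun t => ((X t).2.2 i a).re)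
      ((generator K S Bη Q ε (X t)).2.2 i a).re t := fun t i a =>
    Complex.reCLM.hasFDerivAt.comp_hasDerivAt t
      (hasDerivAt_pi.1 (hasDerivAt_pi.1 (hX t).snd.snd i) a)
  have hout : ∀ i t, (fun a => (modalOutput K i (X t) a).re) =
      sys.C i *ᵥ fun a => ((X t).1 i (Sum.inl a)).re := by
    intro i t
    funext a
    rw [modalOutput_apply, cpx_Chat_mulVec, re_cpx_mulVec]
    rfl
  constructor
  · intro i t _
    refine (hasDerivAt_pi.2 fun a => (h1 t i (Sum.inl a)).congr_deriv ?_).hasDerivWithinAt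
    rw [generator_fst, cpx_Ahat_mulVec, cpx_Dhat_mulVec]
    simp [realSignals, re_cpx_mulVec, add_mulVec, mulVec_add]
    ring
  · exact fun i t _ => hout i t
  · intro j t _
    refine (hasDerivAt_pi.2 fun a => (h2 t j a).congr_deriv ?_).hasDerivWithinAt
    rw [generator_snd_fst]
    simp [realSignals, re_cpx_mulVec]
  · exact fun j t _ => funext fun a => re_cpx_mulVec _ _ a
  · intro i t _
    funext a
    simp [realSignals, modalNodeInput_apply]
  · intro j t _
    funext a
    simp [realSignals, modalEdgeInput_apply]
  · intro i t _
    refine (hasDerivAt_pi.2 fun a => (h3 t i a).congr_deriv ?_).hasDerivWithinAt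
    rw [generator_snd_snd]
    simp [realSignals, re_cpx_mulVec]
  · intro i t _
    refine (hasDerivAt_pi.2 fun a => (h1 t i (Sum.inr a)).congr_deriv ?_).hasDerivWithinAt
    rw [generator_fst, cpx_Ahat_mulVec, cpx_Dhat_mulVec]
    simp only [realSignals, hout]
    simp [← cpx_mul, re_cpx_mulVec, mulVec_sub]
    ring
  · intro i t _
    rfl

-- Starting every exosystem at `η₀` makes the average `η₀` too, so any exosystem trajectory can be
-- prescribed as the synchronized one.
variable (K S Bη Q ε) in
theorem exists_solution_of_exosystem_state (η₀ : Fin q → ℝ) :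
    ∃ σ : Signals K q, IsClosedLoopSolution K S Bη Q ε σ ∧ ∀ i, σ.η i 0 = η₀ := by
  let X₀ : ModalState K q := (0, 0, fun _ a => (η₀ a : ℂ))
  refine ⟨realSignals fun t => NormedSpace.exp (t • generator K S Bη Q ε) X₀,
    isClosedLoopSolution_realSignals fun t => hasDerivAt_exp_smul_apply _ X₀ t, fun i => ?_⟩
  funext a
  have h0 : NormedSpace.exp ((0 : ℝ) • generator K S Bη Q ε) X₀ = X₀ := exp_zero_smul_apply _ _
  simp only [realSignals, h0]
  rfl

/-- A nonzero output matrix detects a persistent mode of the exosystem. -/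
theorem HasSimpleImaginarySpectrum.exists_not_tendsto (hS : HasSimpleImaginarySpectrum S)
    (hQ : Q ≠ 0) : ∃ η₀ : Fin q → ℝ,
      ¬ Tendsto (fun t : ℝ => Q *ᵥ (NormedSpace.exp (t • S) *ᵥ η₀)) atTop (𝓝 0) := by
  by_contra! hall
  -- Decay for the real and imaginary parts of an eigenvector `φ` makes `exp (l t) Q φ` tend to
  -- zero; as `Re l = 0`, its entries have constant modulus, so `Q φ = 0`.
  have h0 : (cpx Q).mulVecLin = 0 := hS.eq_zero_of_eigenvectors _ fun l φ hφ hSφ => by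
    have hl := hS.1 l ((mem_roots_charpoly_iff _ _).2 ⟨φ, hφ, hSφ⟩)
    have hpart : ∀ (ψ : ℂ →L[ℝ] ℝ) (a : Fin p), Tendsto
        (fun t : ℝ => ψ (Complex.exp (l * t) * (cpx Q *ᵥ φ) a)) atTop (𝓝 0) := by
      intro ψ a
      have hsol : ∀ t : ℝ, 0 ≤ t → (fun k => ψ (Complex.exp (l * t) * φ k)) =
          NormedSpace.exp (t • S) *ᵥ fun k => ψ (φ k) := by
        intro t ht
        have := eq_exp_smul_mulVec S (fun t : ℝ => fun k => ψ (Complex.exp (l * t) * φ k))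
          (fun t _ => ?_) t ht
        · simpa using this
        · refine (hasDerivAt_pi.2 fun k => ?_).hasDerivWithinAt
          have h1 : HasDerivAt (fun z : ℂ => Complex.exp (l * z)) (Complex.exp (l * t) * l)
              (t : ℂ) := by
            simpa using ((hasDerivAt_id (t : ℂ)).const_mul l).cexp
          have h2 := ψ.hasFDerivAt.comp_hasDerivAt t (h1.comp_ofReal.mul_const (φ k))
          refine h2.congr_deriv ?_
          have h3 : (Complex.exp (l * t) * l * φ k) =
              (cpx S *ᵥ (Complex.exp (l * t) • φ)) k := by
            rw [mulVec_smul, hSφ]; simp [mul_assoc]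
          rw [h3, map_cpx_mulVec]
          rfl
      have h4 := (tendsto_pi_nhds.1 (hall fun k => ψ (φ k))) a
      refine h4.congr' ?_
      filter_upwards [eventually_ge_atTop (0 : ℝ)] with t ht
      have h6 : (cpx Q *ᵥ (Complex.exp (l * t) • φ)) a = Complex.exp (l * t) * (cpx Q *ᵥ φ) a := by
        rw [mulVec_smul]; rfl
      rw [← hsol t ht, ← h6, map_cpx_mulVec]
      rfl
    funext a
    have hcomplex : Tendsto (fun t : ℝ => Complex.exp (l * t) * (cpx Q *ᵥ φ) a) atTop (𝓝 0) := by
      have h5 := ((Complex.continuous_ofReal.tendsto 0).comp (hpart Complex.reCLM a)).add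
        (((Complex.continuous_ofReal.tendsto 0).comp (hpart Complex.imCLM a)).mul_const Complex.I)
      simp only [Complex.ofReal_zero, zero_mul, add_zero] at h5
      refine h5.congr fun t => ?_
      exact Complex.re_add_im _
    have hnorm := hcomplex.norm
    simp only [norm_mul, Complex.norm_exp, Complex.mul_re, hl, Complex.ofReal_im, mul_zero,
      zero_mul, sub_zero, Real.exp_zero, one_mul, norm_zero] at hnorm
    exact norm_eq_zero.1 (tendsto_nhds_unique tendsto_const_nhds hnorm)
  refine hQ ?_
  ext a k
  have := congrFun (LinearMap.congr_fun h0 (Pi.single k 1)) a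
  simpa using this

end Trajectories

end DynamicEdgeNetwork

/-! ### The synchronization theorem -/

open DynamicEdgeNetwork in
theorem mainTheorem2 {N M p q : ℕ} (sys : MultiAgentSystem N M p) (K : ControllerGains sys)
    (S : Matrix (Fin q) (Fin q) ℝ) (Q : Matrix (Fin p) (Fin q) ℝ)
    (P : Matrix (Fin q) (Fin q) ℝ) (Bη : Matrix (Fin q) (Fin p) ℝ)
    (hA1 : sys.FullRank)
    (hA2 : HasSimpleImaginarySpectrum S)
    (hA3 : ∀ j, IsStrictlyPositiveReal (sys.E j) (sys.F j) (sys.G j))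
    (hA4 : sys.IsConnected)
    (hIM : ∀ i, IncorporatesInternalModel S (K.G₁ i) (K.G₂ i))
    (hA5 : ∀ i, IsHurwitz (K.Ahat i) ∧ IsPassive (K.Ahat i) (K.Dhat i) (K.Chat i))
    (hP : P.PosDef) (hPS : (-(P * S + Sᵀ * P)).PosSemidef)
    (hBη : Bη = P⁻¹ * Qᵀ) :
    ∃ εstar : ℝ, 0 < εstar ∧ ∀ ε : ℝ, 0 < ε → ε < εstar →
      SolvesOutputSynchronization K S Bη Q ε ∧
      ∀ σ : Signals K q, IsClosedLoopSolution K S Bη Q ε σ → ∀ i,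
        Tendsto (fun t => σ.y i t -
            Q *ᵥ (NormedSpace.exp (t • S) *ᵥ ((N : ℝ)⁻¹ • ∑ k, σ.η k 0)))
          atTop (𝓝 0) := by
  obtain ⟨εstar, hpos, hmodes⟩ :=
    exists_gain_unstable_modes K S Bη Q P hA2 hA3 hA4 hIM hA5 hP hPS hBη
  refine ⟨εstar, hpos, fun ε hε hεs => ?_⟩
  have hconv : ∀ σ : Signals K q, IsClosedLoopSolution K S Bη Q ε σ → ∀ i,
      Tendsto (fun t => σ.y i t -
        Q *ᵥ (NormedSpace.exp (t • S) *ᵥ ((N : ℝ)⁻¹ • ∑ k, σ.η k 0))) atTop (𝓝 0) := by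
    intro σ hσ i
    have hlim := tendsto_output_zero (generator K S Bη Q ε)
      (LinearMap.toContinuousLinearMap (syncError K Q i))
      (fun l hl X hX => syncError_eq_zero K Q (hmodes ε hε hεs l hl X hX).2.2.1
        (hmodes ε hε hεs l hl X hX).2.2.2 i)
      (fun l hl X Y hY hX => by
        obtain ⟨h1, h2, h3, h4⟩ := hmodes ε hε hεs l hl Y hY
        exact unstable_modes_semisimple K hA2 hP hPS hBη h1 h2 h3 h4 hX)
      (σ.modalState 0)
    refine tendsto_pi_nhds.2 fun a => ?_
    have h1 := (Complex.continuous_re.tendsto 0).comp ((tendsto_pi_nhds.1 hlim) a)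
    refine h1.congr' ?_
    filter_upwards [eventually_ge_atTop (0 : ℝ)] with t ht
    have h2 := eq_exp_smul_apply (generator K S Bη Q ε) σ.modalState
      (fun t ht => hσ.hasDerivWithinAt_modalState ht) t ht
    simp only [Function.comp_apply, LinearMap.coe_toContinuousLinearMap']
    rw [← h2, hσ.syncError_modalState ht, Complex.ofReal_re]
  refine ⟨⟨fun σ hσ => ⟨fun t => NormedSpace.exp (t • S) *ᵥ ((N : ℝ)⁻¹ • ∑ k, σ.η k 0),
    fun t _ => (hasDerivAt_exp_smul_mulVec S _ t).hasDerivWithinAt, hconv σ hσ⟩, fun hQ => ?_⟩,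
    hconv⟩
  obtain ⟨η₀, hη₀⟩ := hA2.exists_not_tendsto hQ
  obtain ⟨σ, hσ, hση⟩ := exists_solution_of_exosystem_state K S Bη Q ε η₀
  refine ⟨σ, hσ, fun i hi => hη₀ ?_⟩
  have hN : (N : ℝ) ≠ 0 := by have := i.pos; exact_mod_cast this.ne'
  have havg : (N : ℝ)⁻¹ • ∑ k, σ.η k 0 = η₀ := by
    simp only [hση]
    rw [Finset.sum_const, Finset.card_univ, Fintype.card_fin, ← Nat.cast_smul_eq_nsmul ℝ, smul_smul,
      inv_mul_cancel₀ hN, one_smul]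
  -- If some `y i` decayed, subtracting the synchronization error would make `Q exp (t S) η₀` decay
  -- as well.
  have h1 := hi.sub (hconv σ hσ i)
  rw [havg] at h1
  simpa using h1
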